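/- Fix a set $S$ of non-expansive functions $f:\mathbb R^{n}\to\mathbb R$ with $n=\mathrm{ar}(f)\ge 1$, i.e. $|f(a)-f(b)|\le\sum_i|a_i-b_i|$. Consider the following linear $\lambda$-calculus. Types: $\tau,\sigma ::= \mathbf R\mid\mathbf I\mid\tau\multimap\sigma\mid\tau\otimes\sigma$. Terms ($a\in\mathbb R$, $f\in S$, $x,y$ from a countably infinite set of variables): $$M,N ::= x\mid \overline a\mid *\mid \overline f(M_1,\dots,M_{\mathrm{ar}(f)})\mid M\,N\mid\lambda x{:}\tau.\,M\mid M\otimes N\mid \mathsf{let}\ *=M\ \mathsf{in}\ N\mid\mathsf{let}\ x\otimes y=M\ \mathsf{in}\ N .$$ Values: $V,U::=\overline a\mid *\mid\lambda x{:}\tau.M\mid V\otimes U$. Contexts $C[-]$ are terms with exactly one hole; $C[M]$ is obtained by filling the hole with $M$, possibly capturing variables. An environment is a finite list $x_1:\tau_1,\dots,x_k:\tau_k$ of distinct typed variables. $\Gamma\#\Delta$ denotes any order-preserving shuffle of two environments without common variables. Typing: $x:\tau\vdash x:\tau$; $\ \vdash\overline a:\mathbf R$; $\ \vdash *:\mathbf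 I$; if $\Gamma_i\vdash M_i:\mathbf R$ for all $i$, then $\Gamma_1\#\cdots\#\Gamma_n\vdash\overline f(M_1,\dots,M_n):\mathbf R$; if $\Gamma,x:\sigma\vdash M:\tau$, then $\Gamma\vdash\lambda x{:}\sigma.M:\sigma\multimap\tau$; if $\Gamma\vdash M:\sigma\multimap\tau$ and $\Delta\vdash N:\sigma$, then $\Gamma\#\Delta\vdash M\,N:\tau$; if $\Gamma\vdash M:\tau$ and $\Delta\vdash N:\sigma$, then $\Gamma\#\Delta\vdash M\otimes N:\tau\otimes\sigma$; if $\Gamma\vdash M:\mathbf I$ and $\Delta\vdash N:\tau$, then $\Gamma\#\Delta\vdash\mathsf{let}\ *=M\ \mathsf{in}\ N:\tau$; if $\Gamma\vdash M:\sigma_1\otimes\sigma_2$ and $\Delta,x:\sigma_1,y:\sigma_2\vdash N:\tau$, then $\Gamma\#\Delta\vdash\mathsf{let}\ x\otimes y=M\ \mathsf{in}\ N:\tau$. Let $\mathbf{Term}(\Gamma,\tau)=\{M\mid\Gamma\vdash M:\tau\}$, and let $\mathbf{Value}(\tau)$ be the set of closed values of type $\tau$. Write $C[-]:(\Gamma,\tau)\to(\Delta,\sigma)$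 if $\Delta\vdash C[M]:\sigma$ whenever $\Gamma\vdash M:\tau$. Evaluation of closed terms is the call-by-value big-step relation $\hookrightarrow$: $V\hookrightarrow V$; if $M_i\hookrightarrow\overline{a_i}$ for all $i$, then $\overline f(M_1,\dots,M_n)\hookrightarrow\overline{f(a_1,\dots,a_n)}$; if $M\hookrightarrow\lambda x{:}\tau.L$, $N\hookrightarrow V$ and $L[V/x]\hookrightarrow U$, then $M\,N\hookrightarrow U$; if $M\hookrightarrow V$ and $N\hookrightarrow U$, then $M\otimes N\hookrightarrow V\otimes U$; if $M\hookrightarrow *$ and $N\hookrightarrow V$, then $\mathsf{let}\ *=M\ \mathsf{in}\ N\hookrightarrow V$; if $M\hookrightarrow V\otimes U$ and $N[V/x,U/y]\hookrightarrow W$, then $\mathsf{let}\ x\otimes y=M\ \mathsf{in}\ N\hookrightarrow W$. Metric logical relations $\simeq_r^\tau$ between closed terms of type $\tau$, for $r\in[0,\infty]$, are defined by induction on $\tau$: - $M\simeq_r^{\mathbf R}N$ iff $M\hookrightarrow\overline a$ and $N\hookrightarrow\overline b$ with $|a-b|\le r$; - $M\simeq_r^{\mathbf I}N$ iff $M\hookrightarrow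 *$ and $N\hookrightarrow *$; - $M\simeq_r^{\tau\otimes\sigma}N$ iff $M\hookrightarrow V\otimes V'$ and $N\hookrightarrow U\otimes U'$ and there are $s,s'\in[0,\infty]$ with $V\simeq_s^\tau U$, $V'\simeq_{s'}^\sigma U'$ and $s+s'\le r$; - $M\simeq_r^{\tau\multimap\sigma}N$ iff (up to renaming of bound variables) $M\hookrightarrow\lambda x{:}\tau.M'$ and $N\hookrightarrow\lambda x{:}\tau.N'$, and for all $V,U\in\mathbf{Value}(\tau)$ and all $s\in[0,\infty]$, $V\simeq_s^\tau U$ implies $M'[V/x]\simeq_{r+s}^\sigma N'[U/x]$. For $\Gamma=(x:\sigma,\dots,y:\rho)$ and $M,N\in\mathbf{Term}(\Gamma,\tau)$ define the logical metric $$d^{\log}_{\Gamma,\tau}(M,N)=\inf\{r\in[0,\infty]\mid \lambda x{:}\sigma.\cdots\lambda y{:}\rho.\,M\ \simeq_r^{\sigma\multimap\cdots\multimap\rho\multimap\tau}\ \lambda x{:}\sigma.\cdots\lambda y{:}\rho.\,N\}\in[0,\infty]$$ (with $\inf\emptyset=\infty$), and define the observational metric $d^{\mathrm{obs}}_{\Gamma,\tau}(M,N)\in[0,\infty]$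 as the supremum of the numbers $|a_1-b_1|+\cdots+|a_n-b_n|$ over all $n\in\mathbb N$, all types $\sigma$, all contexts $C[-]:(\Gamma,\tau)\to(\varnothing,\mathbf R^{\otimes n}\otimes\sigma)$, and all $a_i,b_i,V,U$ such that $C[M]\hookrightarrow\overline{a_1}\otimes\cdots\otimes\overline{a_n}\otimes V$ and $C[N]\hookrightarrow\overline{b_1}\otimes\cdots\otimes\overline{b_n}\otimes U$. Here $\otimes$ associates to the left, and for $n=0$ the type $\mathbf R^{\otimes n}$ is $\mathbf I$ and the empty tuple is $*$. Theorem. For every environment $\Gamma$ and every type $\tau$, $\ d^{\mathrm{obs}}_{\Gamma,\tau}=d^{\log}_{\Gamma,\tau}$ as functions $\mathbf{Term}(\Gamma,\tau)\times\mathbf{Term}(\Gamma,\tau)\to[0,\infty]$. -/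

import Mathlib

open scoped ENNReal

/-- A non-expansive function `f : ℝ ⊗ ⋯ ⊗ ℝ → ℝ` of arity at least one, where `ℝ ⊗ ⋯ ⊗ ℝ`
carries the sum of the distances of the components. -/
structure NonExp where
  arity : ℕ
  arity_pos : 1 ≤ arity
  toFun : (Fin arity → ℝ) → ℝ
  nonexp : ∀ a b : Fin arity → ℝ, |toFun a - toFun b| ≤ ∑ i, |a i - b i|

namespace LinLang

/-- Types `R`, `I`, `τ ⊸ σ`, `τ ⊗ σ`. -/
inductive Ty : Type
  | real : Ty
  | unit : Ty
  | lolli : Ty → Ty → Ty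
  | tensor : Ty → Ty → Ty

/-- The countably infinite set of variables. -/
abbrev Var : Type := ℕ

/-- Environments, written from right to left: `(x, σ) :: Γ` is the environment `Γ, x : σ`. -/
abbrev Env : Type := List (Var × Ty)

/-- Every variable appears at most once. -/
def Env.WF (Γ : Env) : Prop := (Γ.map Prod.fst).Nodup

/-- `Merge Γ Δ Ξ`: the environment `Ξ` is a merge (an order-preserving shuffle) of `Γ` and `Δ`. -/
inductive Merge : Env → Env → Env → Prop
  | nil : Merge [] [] []
  | left (p : Var × Ty) {Γ Δ Ξ : Env} : Merge Γ Δ Ξ → Merge (p :: Γ) Δ (p :: Ξ)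
  | right (p : Var × Ty) {Γ Δ Ξ : Env} : Merge Γ Δ Ξ → Merge Γ (p :: Δ) (p :: Ξ)

/-- `MergeAll [Γ₁, …, Γₙ] Ξ`: the environment `Ξ` is a merge of `Γ₁, …, Γₙ`. -/
inductive MergeAll : List Env → Env → Prop
  | nil : MergeAll [] []
  | cons {Γ Δ Ξ : Env} {Γs : List Env} :
      MergeAll Γs Δ → Merge Γ Δ Ξ → MergeAll (Γ :: Γs) Ξ

/-- Terms over the set `S` of function symbols (with named variables). -/
inductive Tm (S : Set NonExp) : Type
  | var (x : Var) : Tm S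
  | const (a : ℝ) : Tm S
  | star : Tm S
  | op (f : S) (M : Fin f.1.arity → Tm S) : Tm S
  | app (M N : Tm S) : Tm S
  | lam (x : Var) (τ : Ty) (M : Tm S) : Tm S
  | tensor (M N : Tm S) : Tm S
  | letStar (M N : Tm S) : Tm S
  | letTensor (x y : Var) (M N : Tm S) : Tm S

variable {S : Set NonExp}

/-- Values. -/
inductive IsValue : Tm S → Prop
  | const (a : ℝ) : IsValue (.const a)
  | star : IsValue .star
  | lam (x : Var) (τ : Ty) (M : Tm S) : IsValue (.lam x τ M)
  | tensor {V U : Tm S} : IsValue V → IsValue U → IsValue (.tensor V U)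

/-- The typing judgement `Γ ⊢ M : τ`. The side conditions `Ξ.WF` say that the merged
environments share no variable. -/
inductive HasType : Env → Tm S → Ty → Prop
  | var (x : Var) (τ : Ty) : HasType [(x, τ)] (.var x) τ
  | const (a : ℝ) : HasType [] (.const a) .real
  | star : HasType [] .star .unit
  | op (f : S) (Γ : Fin f.1.arity → Env) (M : Fin f.1.arity → Tm S) {Ξ : Env} :
      (∀ i, HasType (Γ i) (M i) .real) → MergeAll (List.ofFn Γ) Ξ → Ξ.WF →
      HasType Ξ (.op f M) .real
  | lam {Γ : Env} {x : Var} {σ τ : Ty} {M : Tm S} :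
      HasType ((x, σ) :: Γ) M τ → HasType Γ (.lam x σ M) (.lolli σ τ)
  | app {Γ Δ Ξ : Env} {σ τ : Ty} {M N : Tm S} :
      HasType Γ M (.lolli σ τ) → HasType Δ N σ → Merge Γ Δ Ξ → Ξ.WF →
      HasType Ξ (.app M N) τ
  | tensor {Γ Δ Ξ : Env} {τ σ : Ty} {M N : Tm S} :
      HasType Γ M τ → HasType Δ N σ → Merge Γ Δ Ξ → Ξ.WF →
      HasType Ξ (.tensor M N) (.tensor τ σ)
  | letStar {Γ Δ Ξ : Env} {τ : Ty} {M N : Tm S} :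
      HasType Γ M .unit → HasType Δ N τ → Merge Γ Δ Ξ → Ξ.WF →
      HasType Ξ (.letStar M N) τ
  | letTensor {Γ Δ Ξ : Env} {x y : Var} {σ₁ σ₂ τ : Ty} {M N : Tm S} :
      HasType Γ M (.tensor σ₁ σ₂) → HasType ((y, σ₂) :: (x, σ₁) :: Δ) N τ →
      Merge Γ Δ Ξ → Ξ.WF → HasType Ξ (.letTensor x y M N) τ

/-- `M.subst x V` is `M[V/x]`. It replaces the free occurrences of `x`; no bound variable has to be
renamed, because only closed terms `V` are ever substituted. -/
def Tm.subst : Tm S → Var → Tm S → Tm S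
  | .var y, x, V => if y = x then V else .var y
  | .const a, _, _ => .const a
  | .star, _, _ => .star
  | .op f M, x, V => .op f (fun i => (M i).subst x V)
  | .app M N, x, V => .app (M.subst x V) (N.subst x V)
  | .lam y τ M, x, V => .lam y τ (if y = x then M else M.subst x V)
  | .tensor M N, x, V => .tensor (M.subst x V) (N.subst x V)
  | .letStar M N, x, V => .letStar (M.subst x V) (N.subst x V)
  | .letTensor y z M N, x, V =>
      .letTensor y z (M.subst x V) (if y = x ∨ z = x then N else N.subst x V)

/-- The big-step (call-by-value) evaluation relation `M ↪ V` on closed terms. In the last rule the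
substitution `N[V/x, U/y]` is done one variable after the other, which is the same since `V` and
`U` are closed and `x ≠ y`. -/
inductive Eval : Tm S → Tm S → Prop
  | value {V : Tm S} : IsValue V → Eval V V
  | op (f : S) (M : Fin f.1.arity → Tm S) (a : Fin f.1.arity → ℝ) :
      (∀ i, Eval (M i) (.const (a i))) → Eval (.op f M) (.const (f.1.toFun a))
  | app {M N L V U : Tm S} {x : Var} {τ : Ty} :
      Eval M (.lam x τ L) → Eval N V → Eval (L.subst x V) U → Eval (.app M N) U
  | tensor {M N V U : Tm S} : Eval M V → Eval N U → Eval (.tensor M N) (.tensor V U)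
  | letStar {M N V : Tm S} : Eval M .star → Eval N V → Eval (.letStar M N) V
  | letTensor {M N V U W : Tm S} {x y : Var} :
      Eval M (.tensor V U) → Eval ((N.subst x V).subst y U) W →
      Eval (.letTensor x y M N) W

/-- Contexts `C[-]`: terms with exactly one hole. In `op f i M C` the hole is in the argument with
index `i`; the other arguments are `M j` for `j ≠ i`, and `M i` plays no role. -/
inductive Cxt (S : Set NonExp) : Type
  | hole : Cxt S
  | op (f : S) (i : Fin f.1.arity) (M : Fin f.1.arity → Tm S) (C : Cxt S) : Cxt S
  | appL (C : Cxt S) (M : Tm S) : Cxt S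
  | appR (M : Tm S) (C : Cxt S) : Cxt S
  | lam (x : Var) (τ : Ty) (C : Cxt S) : Cxt S
  | tensorL (C : Cxt S) (M : Tm S) : Cxt S
  | tensorR (M : Tm S) (C : Cxt S) : Cxt S
  | letStarL (C : Cxt S) (M : Tm S) : Cxt S
  | letStarR (M : Tm S) (C : Cxt S) : Cxt S
  | letTensorL (x y : Var) (C : Cxt S) (M : Tm S) : Cxt S
  | letTensorR (x y : Var) (M : Tm S) (C : Cxt S) : Cxt S

/-- `C.plug M` is `C[M]`; variables of `M` may be captured. -/
def Cxt.plug (P : Tm S) : Cxt S → Tm S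
  | .hole => P
  | .op f i M C => .op f (Function.update M i (C.plug P))
  | .appL C M => .app (C.plug P) M
  | .appR M C => .app M (C.plug P)
  | .lam x τ C => .lam x τ (C.plug P)
  | .tensorL C M => .tensor (C.plug P) M
  | .tensorR M C => .tensor M (C.plug P)
  | .letStarL C M => .letStar (C.plug P) M
  | .letStarR M C => .letStar M (C.plug P)
  | .letTensorL x y C M => .letTensor x y (C.plug P) M
  | .letTensorR x y M C => .letTensor x y M (C.plug P)

/-- `C[-] : (Γ, τ) → (Δ, σ)`. -/
def Cxt.HasType (C : Cxt S) (Γ : Env) (τ : Ty) (Δ : Env) (σ : Ty) : Prop :=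
  ∀ M : Tm S, LinLang.HasType Γ M τ → LinLang.HasType Δ (C.plug M) σ

/-- The set `Term(Γ, τ)`. -/
def Term (S : Set NonExp) (Γ : Env) (τ : Ty) : Type := {M : Tm S // HasType Γ M τ}

/-- `V ∈ Value(τ)`: a closed value of type `τ`. -/
def IsClosedValue (τ : Ty) (V : Tm S) : Prop := IsValue V ∧ HasType [] V τ

/-- The metric logical relation `M ≃_r^τ N` between closed terms of type `τ`. As terms are not
identified up to renaming of bound variables, the two bound variables in the last clause may
have different names. -/
def LogRel : Ty → ℝ≥0∞ → Tm S → Tm S → Prop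
  | .real, r, M, N =>
      ∃ a b : ℝ, Eval M (.const a) ∧ Eval N (.const b) ∧ ENNReal.ofReal |a - b| ≤ r
  | .unit, _, M, N => Eval M .star ∧ Eval N .star
  | .tensor τ σ, r, M, N =>
      ∃ V V' U U' : Tm S, Eval M (.tensor V V') ∧ Eval N (.tensor U U') ∧
        ∃ s s' : ℝ≥0∞, LogRel τ s V U ∧ LogRel σ s' V' U' ∧ s + s' ≤ r
  | .lolli τ σ, r, M, N =>
      ∃ (x y : Var) (M' N' : Tm S), Eval M (.lam x τ M') ∧ Eval N (.lam y τ N') ∧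
        ∀ (V U : Tm S) (s : ℝ≥0∞), IsClosedValue τ V → IsClosedValue τ U → LogRel τ s V U →
          LogRel σ (r + s) (M'.subst x V) (N'.subst y U)

/-- For `Γ = (x : σ, …, y : ρ)`, the term `λx:σ. ⋯ λy:ρ. M`. -/
def Env.close : Env → Tm S → Tm S
  | [], M => M
  | (y, ρ) :: Γ, M => Env.close Γ (.lam y ρ M)

/-- For `Γ = (x : σ, …, y : ρ)`, the type `σ ⊸ ⋯ ⊸ ρ ⊸ τ`. -/
def Env.closeTy : Env → Ty → Ty
  | [], τ => τ
  | (_, ρ) :: Γ, τ => Env.closeTy Γ (.lolli ρ τ)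

/-- The logical metric on `Term(Γ, τ)`. -/
noncomputable def dLog (S : Set NonExp) (Γ : Env) (τ : Ty) (M N : Term S Γ τ) : ℝ≥0∞ :=
  sInf {r : ℝ≥0∞ | LogRel (Γ.closeTy τ) r (Γ.close M.1) (Γ.close N.1)}

/-- The type `R ⊗ ⋯ ⊗ R` (`n` factors, bracketed to the left), which is `I` for `n = 0`. -/
def Ty.rpow : ℕ → Ty
  | 0 => .unit
  | 1 => .real
  | n + 2 => .tensor (Ty.rpow (n + 1)) .real

/-- The term `a₁ ⊗ ⋯ ⊗ aₙ` (bracketed to the left), which is `*` for `n = 0`. -/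
def Tm.tuple : (n : ℕ) → (Fin n → ℝ) → Tm S
  | 0, _ => .star
  | 1, a => .const (a 0)
  | n + 2, a => .tensor (Tm.tuple (n + 1) fun i => a i.castSucc) (.const (a (Fin.last (n + 1))))

/-- The observational metric on `Term(Γ, τ)`. -/
noncomputable def dObs (S : Set NonExp) (Γ : Env) (τ : Ty) (M N : Term S Γ τ) : ℝ≥0∞ :=
  sSup {d : ℝ≥0∞ | ∃ (n : ℕ) (σ : Ty) (C : Cxt S),
    C.HasType Γ τ [] (.tensor (Ty.rpow n) σ) ∧
    ∃ (a b : Fin n → ℝ) (V U : Tm S),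
      Eval (C.plug M.1) (.tensor (Tm.tuple n a) V) ∧
      Eval (C.plug N.1) (.tensor (Tm.tuple n b) U) ∧
      d = ENNReal.ofReal (∑ i, |a i - b i|)}

end LinLang

namespace LinLang

variable {S : Set NonExp}

/-! ### Environments and merges -/

theorem Merge.perm_append {Γ Δ Ξ : Env} (h : Merge Γ Δ Ξ) : Ξ.Perm (Γ ++ Δ) := by
  induction h with
  | nil => exact .refl _
  | left p _ ih => exact ih.cons p
  | right p _ ih => exact (ih.cons p).trans List.perm_middle.symm

theorem MergeAll.perm_flatten {Γs : List Env} {Ξ : Env} (h : MergeAll Γs Ξ) :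
    Ξ.Perm Γs.flatten := by
  induction h with
  | nil => exact .refl _
  | cons _ hm ih => exact hm.perm_append.trans (ih.append_left _)

theorem Merge.mem_left {Γ Δ Ξ : Env} (h : Merge Γ Δ Ξ) {p : Var × Ty} (hp : p ∈ Γ) : p ∈ Ξ :=
  h.perm_append.mem_iff.2 (List.mem_append_left _ hp)

theorem Merge.mem_right {Γ Δ Ξ : Env} (h : Merge Γ Δ Ξ) {p : Var × Ty} (hp : p ∈ Δ) : p ∈ Ξ :=
  h.perm_append.mem_iff.2 (List.mem_append_right _ hp)

theorem MergeAll.mem {n : ℕ} {Γ : Fin n → Env} {Ξ : Env} (h : MergeAll (List.ofFn Γ) Ξ)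
    {i : Fin n} {p : Var × Ty} (hp : p ∈ Γ i) : p ∈ Ξ :=
  h.perm_flatten.mem_iff.2 (List.mem_flatten.2 ⟨Γ i, (List.mem_ofFn).2 ⟨i, rfl⟩, hp⟩)

theorem Merge.eq_nil {Γ Δ : Env} (h : Merge Γ Δ []) : Γ = [] ∧ Δ = [] := by
  cases h; exact ⟨rfl, rfl⟩

theorem MergeAll.eq_nil {n : ℕ} {Γ : Fin n → Env} (h : MergeAll (List.ofFn Γ) []) (i : Fin n) :
    Γ i = [] :=
  List.eq_nil_iff_forall_not_mem.2 fun _ hp => List.not_mem_nil (h.mem hp)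

/-- Substituting closed terms deletes the substituted variables from the environment; a merge
survives this deletion. -/
theorem Merge.filter {Γ Δ Ξ : Env} (h : Merge Γ Δ Ξ) (p : Var × Ty → Bool) :
    Merge (Γ.filter p) (Δ.filter p) (Ξ.filter p) := by
  induction h with
  | nil => exact .nil
  | left q _ ih => by_cases hq : p q <;> simp [hq, ih, Merge.left]
  | right q _ ih => by_cases hq : p q <;> simp [hq, ih, Merge.right]

theorem MergeAll.filter {Γs : List Env} {Ξ : Env} (h : MergeAll Γs Ξ) (p : Var × Ty → Bool) :
    MergeAll (Γs.map (List.filter p)) (Ξ.filter p) := by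
  induction h with
  | nil => exact .nil
  | cons _ hm ih => exact .cons ih (hm.filter p)

theorem Merge.nil_left : ∀ Δ : Env, Merge [] Δ Δ
  | [] => .nil
  | p :: Δ => .right p (Merge.nil_left Δ)

theorem Merge.nil_right : ∀ Γ : Env, Merge Γ [] Γ
  | [] => .nil
  | p :: Γ => .left p (Merge.nil_right Γ)

/-- Each entry of the merged environment remembers the side that it came from, so a permutation of
the whole induces permutations of the two sides. -/
theorem Merge.exchange {Γ Δ Ξ Ξ' : Env} (h : Merge Γ Δ Ξ) (hp : Ξ.Perm Ξ') :
    ∃ Γ' Δ', Γ.Perm Γ' ∧ Δ.Perm Δ' ∧ Merge Γ' Δ' Ξ' := by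
  induction hp generalizing Γ Δ with
  | nil => exact ⟨Γ, Δ, .refl _, .refl _, h⟩
  | cons p _ ih =>
    cases h with
    | left _ h =>
      obtain ⟨Γ', Δ', h₁, h₂, h₃⟩ := ih h
      exact ⟨_, _, h₁.cons p, h₂, h₃.left p⟩
    | right _ h =>
      obtain ⟨Γ', Δ', h₁, h₂, h₃⟩ := ih h
      exact ⟨_, _, h₁, h₂.cons p, h₃.right p⟩
  | swap p q l =>
    cases h with
    | left _ h =>
      cases h with
      | left _ h => exact ⟨_, _, .swap _ _ _, .refl _, (h.left q).left p⟩
      | right _ h => exact ⟨_, _, .refl _, .refl _, (h.left q).right p⟩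
    | right _ h =>
      cases h with
      | left _ h => exact ⟨_, _, .refl _, .refl _, (h.right q).left p⟩
      | right _ h => exact ⟨_, _, .refl _, .swap _ _ _, (h.right q).right p⟩
  | trans _ _ ih₁ ih₂ =>
    obtain ⟨Γ', Δ', h₁, h₂, h₃⟩ := ih₁ h
    obtain ⟨Γ'', Δ'', h₁', h₂', h₃'⟩ := ih₂ h₃
    exact ⟨_, _, h₁.trans h₁', h₂.trans h₂', h₃'⟩

theorem MergeAll.exchange {Γs : List Env} {Ξ Ξ' : Env} (h : MergeAll Γs Ξ) (hp : Ξ.Perm Ξ') :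
    ∃ Γs', List.Forall₂ List.Perm Γs Γs' ∧ MergeAll Γs' Ξ' := by
  induction h generalizing Ξ' with
  | nil => exact ⟨[], .nil, by rw [List.nil_perm.1 hp]; exact .nil⟩
  | cons _ hm ih =>
    obtain ⟨Γ', Δ', h₁, h₂, h₃⟩ := hm.exchange hp
    obtain ⟨Γs', h₄, h₅⟩ := ih h₂
    exact ⟨_, .cons h₁ h₄, .cons h₅ h₃⟩

theorem MergeAll.exchange_ofFn {n : ℕ} {Γ : Fin n → Env} {Ξ Ξ' : Env}
    (h : MergeAll (List.ofFn Γ) Ξ) (hp : Ξ.Perm Ξ') :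
    ∃ Γ' : Fin n → Env, (∀ i, (Γ i).Perm (Γ' i)) ∧ MergeAll (List.ofFn Γ') Ξ' := by
  obtain ⟨Γs', h₁, h₂⟩ := h.exchange hp
  have hl : Γs'.length = n := by rw [← h₁.length_eq, List.length_ofFn]
  subst hl
  refine ⟨Γs'.get, fun i => ?_, by rwa [List.ofFn_get]⟩
  have := (List.forall₂_iff_get.1 h₁).2 i (by simp) i.2
  simpa using this

/-! ### Well-formed environments and the exchange rule -/

theorem Env.WF.perm {Γ Δ : Env} (h : Γ.WF) (hp : Γ.Perm Δ) : Δ.WF :=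
  (hp.map Prod.fst).nodup_iff.1 h

theorem Env.WF.ne {x : Var} {σ : Ty} {Γ : Env} (h : Env.WF ((x, σ) :: Γ)) {y : Var} {ρ : Ty}
    (hy : (y, ρ) ∈ Γ) : y ≠ x := by
  rintro rfl
  exact (List.nodup_cons.1 h).1 (List.mem_map.2 ⟨_, hy, rfl⟩)

theorem Env.WF.tail {p : Var × Ty} {Γ : Env} (h : Env.WF (p :: Γ)) : Γ.WF :=
  (List.nodup_cons.1 h).2

theorem Env.wf_nil : Env.WF [] := List.nodup_nil

theorem HasType.wf {Γ : Env} {M : Tm S} {τ : Ty} (h : HasType Γ M τ) : Γ.WF := by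
  induction h with
  | var x τ => exact List.nodup_singleton _
  | const | star => exact Env.wf_nil
  | lam _ ih => exact ih.tail
  | op | app | tensor | letStar | letTensor => assumption

/-- Exchange is not a typing rule, and binders take only the most recent variables. It is admissible
because merges can be rearranged. -/
theorem HasType.exchange {Γ Γ' : Env} {M : Tm S} {τ : Ty} (h : HasType Γ M τ)
    (hp : Γ.Perm Γ') : HasType Γ' M τ := by
  induction h generalizing Γ' with
  | var x τ => rw [← List.singleton_perm.1 hp]; exact .var x τ
  | const => rw [List.nil_perm.1 hp]; exact .const _
  | star => rw [List.nil_perm.1 hp]; exact .star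
  | op f Γ M _ hm hw ih =>
    obtain ⟨Γ', h₁, h₂⟩ := hm.exchange_ofFn hp
    exact .op f Γ' M (fun i => ih i (h₁ i)) h₂ (hw.perm hp)
  | lam _ ih => exact .lam (ih (hp.cons _))
  | app _ _ hm hw ih₁ ih₂ =>
    obtain ⟨Γ', Δ', h₁, h₂, h₃⟩ := hm.exchange hp
    exact .app (ih₁ h₁) (ih₂ h₂) h₃ (hw.perm hp)
  | tensor _ _ hm hw ih₁ ih₂ =>
    obtain ⟨Γ', Δ', h₁, h₂, h₃⟩ := hm.exchange hp
    exact .tensor (ih₁ h₁) (ih₂ h₂) h₃ (hw.perm hp)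
  | letStar _ _ hm hw ih₁ ih₂ =>
    obtain ⟨Γ', Δ', h₁, h₂, h₃⟩ := hm.exchange hp
    exact .letStar (ih₁ h₁) (ih₂ h₂) h₃ (hw.perm hp)
  | letTensor _ _ hm hw ih₁ ih₂ =>
    obtain ⟨Γ', Δ', h₁, h₂, h₃⟩ := hm.exchange hp
    exact .letTensor (ih₁ h₁) (ih₂ ((h₂.cons _).cons _)) h₃ (hw.perm hp)

/-! ### Free variables -/

/-- `M.Free x`: the variable `x` occurs free in `M`. -/
def Tm.Free : Tm S → Var → Prop
  | .var y, x => x = y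
  | .const _, _ => False
  | .star, _ => False
  | .op _ M, x => ∃ i, (M i).Free x
  | .app M N, x => M.Free x ∨ N.Free x
  | .lam y _ M, x => x ≠ y ∧ M.Free x
  | .tensor M N, x => M.Free x ∨ N.Free x
  | .letStar M N, x => M.Free x ∨ N.Free x
  | .letTensor y z M N, x => M.Free x ∨ (x ≠ y ∧ x ≠ z ∧ N.Free x)

theorem Merge.exists_mem_iff {Γ Δ Ξ : Env} (h : Merge Γ Δ Ξ) (x : Var) :
    (∃ σ, (x, σ) ∈ Ξ) ↔ (∃ σ, (x, σ) ∈ Γ) ∨ ∃ σ, (x, σ) ∈ Δ := by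
  simp only [h.perm_append.mem_iff, List.mem_append, exists_or]

/-- By linearity the environment lists exactly the free variables: none is missing and none is idle.
-/
theorem HasType.free_iff {Γ : Env} {M : Tm S} {τ : Ty} (h : HasType Γ M τ) (x : Var) :
    M.Free x ↔ ∃ σ, (x, σ) ∈ Γ := by
  induction h with
  | var y τ => simp [Tm.Free]
  | const | star => simp [Tm.Free]
  | op f Γ M _ hm _ ih =>
    simp only [Tm.Free, ih, hm.perm_flatten.mem_iff, List.mem_flatten, List.mem_ofFn]
    constructor
    · rintro ⟨i, σ, hi⟩
      exact ⟨σ, Γ i, ⟨i, rfl⟩, hi⟩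
    · rintro ⟨σ, _, ⟨i, rfl⟩, hi⟩
      exact ⟨i, σ, hi⟩
  | @lam Γ y σ τ M h ih =>
    simp only [Tm.Free, ih, List.mem_cons, Prod.mk.injEq]
    constructor
    · rintro ⟨hx, ρ, ⟨rfl, -⟩ | hρ⟩
      · exact absurd rfl hx
      · exact ⟨ρ, hρ⟩
    · rintro ⟨ρ, hρ⟩
      exact ⟨h.wf.ne hρ, ρ, .inr hρ⟩
  | app _ _ hm _ ih₁ ih₂ | tensor _ _ hm _ ih₁ ih₂ | letStar _ _ hm _ ih₁ ih₂ =>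
    simp only [Tm.Free, ih₁, ih₂, hm.exists_mem_iff]
  | @letTensor Γ Δ Ξ y z σ₁ σ₂ τ M N _ h hm _ ih₁ ih₂ =>
    simp only [Tm.Free, ih₁, ih₂, hm.exists_mem_iff, List.mem_cons, Prod.mk.injEq]
    refine or_congr_right ⟨?_, ?_⟩
    · rintro ⟨h₁, h₂, ρ, ⟨rfl, -⟩ | ⟨rfl, -⟩ | hρ⟩
      · exact absurd rfl h₂
      · exact absurd rfl h₁
      · exact ⟨ρ, hρ⟩
    · rintro ⟨ρ, hρ⟩
      exact ⟨h.wf.tail.ne hρ, h.wf.ne (List.mem_cons_of_mem _ hρ), ρ, .inr (.inr hρ)⟩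

/-! ### Simultaneous substitution -/

/-- Simultaneous substitution of `ρ x` for all free variables `x`, without renaming. -/
def Tm.msub : Tm S → (Var → Tm S) → Tm S
  | .var y, ρ => ρ y
  | .const a, _ => .const a
  | .star, _ => .star
  | .op f M, ρ => .op f (fun i => (M i).msub ρ)
  | .app M N, ρ => .app (M.msub ρ) (N.msub ρ)
  | .lam y τ M, ρ => .lam y τ (M.msub (Function.update ρ y (.var y)))
  | .tensor M N, ρ => .tensor (M.msub ρ) (N.msub ρ)
  | .letStar M N, ρ => .letStar (M.msub ρ) (N.msub ρ)
  | .letTensor y z M N, ρ =>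
      .letTensor y z (M.msub ρ)
        (N.msub (Function.update (Function.update ρ y (.var y)) z (.var z)))

theorem Tm.msub_eq_self (M : Tm S) (ρ : Var → Tm S) (h : ∀ x, M.Free x → ρ x = .var x) :
    M.msub ρ = M := by
  induction M generalizing ρ with
  | var x => exact h x rfl
  | const | star => rfl
  | op f M ih => simp only [Tm.msub, fun i => ih i ρ fun x hx => h x ⟨i, hx⟩]
  | app M N ih₁ ih₂ | tensor M N ih₁ ih₂ | letStar M N ih₁ ih₂ =>
    simp only [Tm.msub, ih₁ ρ fun x hx => h x (.inl hx), ih₂ ρ fun x hx => h x (.inr hx)]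
  | lam y τ M ih =>
    rw [Tm.msub, ih]
    intro x hx
    by_cases hxy : x = y
    · subst hxy; simp
    · simpa [hxy] using h x ⟨hxy, hx⟩
  | letTensor y z M N ih₁ ih₂ =>
    rw [Tm.msub, ih₁ ρ fun x hx => h x (.inl hx), ih₂]
    intro x hx
    by_cases hxz : x = z
    · subst hxz; simp
    by_cases hxy : x = y
    · subst hxy; simp [hxz]
    · simpa [hxy, hxz] using h x (.inr ⟨hxy, hxz, hx⟩)

/-- This is the step of β-reduction under a closing substitution: below a binder of `y` the
substitution fixes `y`, and the argument is filled in later. The hypothesis ensures that the late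
substitution does not touch the terms already inserted. -/
theorem Tm.subst_msub (M : Tm S) (ρ : Var → Tm S) (y : Var) (V : Tm S)
    (h : ∀ x, x ≠ y → (ρ x).subst y V = ρ x) :
    (M.msub (Function.update ρ y (.var y))).subst y V = M.msub (Function.update ρ y V) := by
  have hu : ∀ (ρ : Var → Tm S) z, (∀ x, x ≠ y → (ρ x).subst y V = ρ x) →
      ∀ x, x ≠ y → (Function.update ρ z (.var z) x).subst y V =
        Function.update ρ z (.var z) x := by
    intro ρ z h x hx
    by_cases hxz : x = z
    · subst hxz; simp [Tm.subst, hx]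
    · simpa [hxz] using h x hx
  induction M generalizing ρ with
  | var x =>
    by_cases hx : x = y
    · subst hx; simp [Tm.msub, Tm.subst]
    · simpa [Tm.msub, hx] using h x hx
  | const | star => rfl
  | op f M ih => simp only [Tm.msub, Tm.subst, ih _ ρ h]
  | app M N ih₁ ih₂ | tensor M N ih₁ ih₂ | letStar M N ih₁ ih₂ =>
    simp only [Tm.msub, Tm.subst, ih₁ ρ h, ih₂ ρ h]
  | lam z τ M ih =>
    by_cases hz : z = y
    · subst hz; simp [Tm.msub, Tm.subst]
    · simp only [Tm.msub, Tm.subst, if_neg hz]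
      rw [Function.update_comm (Ne.symm hz), ih _ (hu ρ z h), Function.update_comm hz]
  | letTensor x z M N ih₁ ih₂ =>
    simp only [Tm.msub, Tm.subst, ih₁ ρ h]
    by_cases hx : x = y
    · subst hx; simp
    by_cases hz : z = y
    · subst hz
      simp [Function.update_comm hx]
    · rw [if_neg (by tauto), Function.update_comm (Ne.symm hx), Function.update_comm (Ne.symm hz),
        ih₂ _ (hu _ z (hu ρ x h)), Function.update_comm hz, Function.update_comm hx]

theorem Tm.subst_eq_msub (M : Tm S) (x : Var) (V : Tm S) :
    M.subst x V = M.msub (Function.update Tm.var x V) := by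
  rw [← Tm.subst_msub M _ x V fun y hy => by simp [Tm.subst, hy], Function.update_eq_self,
    Tm.msub_eq_self _ _ fun _ _ => rfl]

theorem Tm.subst_eq_self (M : Tm S) (x : Var) (V : Tm S) (h : ¬ M.Free x) : M.subst x V = M := by
  rw [Tm.subst_eq_msub]
  refine Tm.msub_eq_self _ _ fun y hy => ?_
  rw [Function.update_of_ne]
  rintro rfl
  exact h hy

theorem HasType.not_free {M : Tm S} {τ : Ty} (h : HasType [] M τ) (x : Var) : ¬ M.Free x := by
  simp [h.free_iff]

theorem HasType.subst_closed {M : Tm S} {τ : Ty} (h : HasType [] M τ) (x : Var) (V : Tm S) :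
    M.subst x V = M :=
  Tm.subst_eq_self _ _ _ (h.not_free x)

theorem HasType.msub_closed {M : Tm S} {τ : Ty} (h : HasType [] M τ) (ρ : Var → Tm S) :
    M.msub ρ = M :=
  Tm.msub_eq_self _ _ fun x hx => absurd hx (h.not_free x)

/-- A partial substitution is the form stable under binders: `p` marks the variables that are kept,
and a bound variable is added to them. Full closing (`p` constantly false) and the substitution of a
single variable are both instances. -/
theorem HasType.msub_filter {Γ : Env} {M : Tm S} {τ : Ty} (h : HasType Γ M τ)
    (p : Var → Bool) (ρ : Var → Tm S)
    (h₁ : ∀ x σ, (x, σ) ∈ Γ → p x = true → ρ x = .var x)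
    (h₂ : ∀ x σ, (x, σ) ∈ Γ → p x = false → HasType [] (ρ x) σ) :
    HasType (Γ.filter fun q => p q.1) (M.msub ρ) τ := by
  induction h generalizing p ρ with
  | var x τ =>
    cases hp : p x with
    | true =>
      have := h₁ x τ (by simp) hp
      simpa [hp, Tm.msub, this] using HasType.var x τ
    | false => simpa [hp, Tm.msub] using h₂ x τ (by simp) hp
  | const => exact .const _
  | star => exact .star
  | op f Γ M _ hm hw ih =>
    refine .op f (fun i => (Γ i).filter fun q => p q.1) _
      (fun i => ih i p ρ (fun x σ hx => h₁ x σ (hm.mem hx)) fun x σ hx => h₂ x σ (hm.mem hx))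
      ?_ (hw.sublist (List.filter_sublist.map _))
    simpa [List.map_ofFn, Function.comp_def] using hm.filter fun q => p q.1
  | @lam Γ y σ τ M h ih =>
    have hy : ∀ q ∈ Γ, q.1 ≠ y := fun q hq => h.wf.ne (ρ := q.2) hq
    have := ih (Function.update p y true) (Function.update ρ y (.var y)) ?_ ?_
    · refine .lam ?_
      rw [List.filter_cons_of_pos (by simp)] at this
      convert this using 2
      exact List.filter_congr fun q hq => by simp [hy q hq]
    · intro x ρ' hx hpx
      rcases List.mem_cons.1 hx with hx | hx
      · cases hx; simp
      · have hne := hy _ hx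
        simp only [ne_eq] at hne
        simp only [Function.update_of_ne hne] at hpx ⊢
        exact h₁ x ρ' hx hpx
    · intro x ρ' hx hpx
      rcases List.mem_cons.1 hx with hx | hx
      · cases hx; simp at hpx
      · have hne := hy _ hx
        simp only [ne_eq] at hne
        simp only [Function.update_of_ne hne] at hpx ⊢
        exact h₂ x ρ' hx hpx
  | app _ _ hm hw ih₁ ih₂ =>
    exact .app
      (ih₁ p ρ (fun x σ hx => h₁ x σ (hm.mem_left hx)) fun x σ hx => h₂ x σ (hm.mem_left hx))
      (ih₂ p ρ (fun x σ hx => h₁ x σ (hm.mem_right hx)) fun x σ hx => h₂ x σ (hm.mem_right hx))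
      (hm.filter _) (hw.sublist (List.filter_sublist.map _))
  | tensor _ _ hm hw ih₁ ih₂ =>
    exact .tensor
      (ih₁ p ρ (fun x σ hx => h₁ x σ (hm.mem_left hx)) fun x σ hx => h₂ x σ (hm.mem_left hx))
      (ih₂ p ρ (fun x σ hx => h₁ x σ (hm.mem_right hx)) fun x σ hx => h₂ x σ (hm.mem_right hx))
      (hm.filter _) (hw.sublist (List.filter_sublist.map _))
  | letStar _ _ hm hw ih₁ ih₂ =>
    exact .letStar
      (ih₁ p ρ (fun x σ hx => h₁ x σ (hm.mem_left hx)) fun x σ hx => h₂ x σ (hm.mem_left hx))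
      (ih₂ p ρ (fun x σ hx => h₁ x σ (hm.mem_right hx)) fun x σ hx => h₂ x σ (hm.mem_right hx))
      (hm.filter _) (hw.sublist (List.filter_sublist.map _))
  | @letTensor Γ Δ Ξ y z σ₁ σ₂ τ M N _ h hm hw ih₁ ih₂ =>
    have hz : ∀ q ∈ Δ, q.1 ≠ z := fun q hq => h.wf.ne (ρ := q.2) (List.mem_cons_of_mem _ hq)
    have hy : ∀ q ∈ Δ, q.1 ≠ y := fun q hq => h.wf.tail.ne (ρ := q.2) hq
    have hyz : y ≠ z := h.wf.ne List.mem_cons_self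
    refine .letTensor
      (ih₁ p ρ (fun x σ hx => h₁ x σ (hm.mem_left hx)) fun x σ hx => h₂ x σ (hm.mem_left hx))
      ?_ (hm.filter _) (hw.sublist (List.filter_sublist.map _))
    have := ih₂ (Function.update (Function.update p y true) z true)
      (Function.update (Function.update ρ y (.var y)) z (.var z)) ?_ ?_
    · rw [List.filter_cons_of_pos (by simp), List.filter_cons_of_pos (by simp [hyz])] at this
      convert this using 3
      exact List.filter_congr fun q hq => by simp [hy q hq, hz q hq]
    · intro x ρ' hx hpx
      rcases List.mem_cons.1 hx with hx | hx
      · cases hx; simp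
      rcases List.mem_cons.1 hx with hx | hx
      · cases hx; simp [hyz]
      · have hne₁ := hy _ hx
        have hne₂ := hz _ hx
        simp only [ne_eq] at hne₁ hne₂
        simp only [Function.update_of_ne hne₂, Function.update_of_ne hne₁] at hpx ⊢
        exact h₁ x ρ' (hm.mem_right hx) hpx
    · intro x ρ' hx hpx
      rcases List.mem_cons.1 hx with hx | hx
      · cases hx; simp at hpx
      rcases List.mem_cons.1 hx with hx | hx
      · cases hx; simp [hyz] at hpx
      · have hne₁ := hy _ hx
        have hne₂ := hz _ hx
        simp only [ne_eq] at hne₁ hne₂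
        simp only [Function.update_of_ne hne₂, Function.update_of_ne hne₁] at hpx ⊢
        exact h₂ x ρ' (hm.mem_right hx) hpx

theorem HasType.msub {Γ : Env} {M : Tm S} {τ : Ty} (h : HasType Γ M τ) (ρ : Var → Tm S)
    (hρ : ∀ x σ, (x, σ) ∈ Γ → HasType [] (ρ x) σ) : HasType [] (M.msub ρ) τ := by
  simpa using h.msub_filter (fun _ => false) ρ (by simp) fun x σ hx _ => hρ x σ hx

theorem HasType.subst {Γ : Env} {M V : Tm S} {x : Var} {σ τ : Ty}
    (h : HasType ((x, σ) :: Γ) M τ) (hV : HasType [] V σ) : HasType Γ (M.subst x V) τ := by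
  have := h.msub_filter (fun y => y ≠ x) (Function.update Tm.var x V)
    (fun y ρ _ hy => by simp at hy; simp [hy]) ?_
  · rw [Tm.subst_eq_msub]
    rw [List.filter_cons_of_neg (by simp), List.filter_eq_self.2] at this
    · exact this
    · intro q hq
      simpa using h.wf.ne (ρ := q.2) hq
  · intro y ρ hy hyx
    rcases List.mem_cons.1 hy with hy | hy
    · cases hy; simpa using hV
    · simpa using absurd hyx (by simpa using h.wf.ne hy)

theorem HasType.subst₂ {M V U : Tm S} {x y : Var} {σ₁ σ₂ τ : Ty}
    (h : HasType [(y, σ₂), (x, σ₁)] M τ) (hV : HasType [] V σ₁) (hU : HasType [] U σ₂) :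
    HasType [] ((M.subst x V).subst y U) τ :=
  ((h.exchange (.swap _ _ _)).subst hV).subst hU

/-! ### Evaluation -/

theorem Eval.isValue {M V : Tm S} (h : Eval M V) : IsValue V := by
  induction h with
  | value h => exact h
  | op => exact .const _
  | tensor _ _ h₁ h₂ => exact .tensor h₁ h₂
  | app | letStar | letTensor => assumption

theorem IsValue.eval_eq {V W : Tm S} (hV : IsValue V) (h : Eval V W) : W = V := by
  induction hV generalizing W with
  | const | star | lam => cases h; rfl
  | tensor _ _ ih₁ ih₂ =>
    cases h with
    | value => rfl
    | tensor h₁ h₂ => rw [ih₁ h₁, ih₂ h₂]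

theorem Eval.self {M V : Tm S} (h : Eval M V) : Eval V V := .value h.isValue

theorem Eval.det {M V W : Tm S} (h : Eval M V) (h' : Eval M W) : V = W := by
  induction h generalizing W with
  | value hV => exact (hV.eval_eq h').symm
  | op f M a h ih =>
    cases h' with
    | value hv => cases hv
    | op _ _ b hb =>
      have : a = b := funext fun i => by simpa using ih i (hb i)
      rw [this]
  | app _ _ _ ih₁ ih₂ ih₃ =>
    cases h' with
    | value hv => cases hv
    | app h₁ h₂ h₃ =>
      cases ih₁ h₁
      cases ih₂ h₂
      exact ih₃ h₃
  | tensor h₁ h₂ ih₁ ih₂ =>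
    cases h' with
    | value hv =>
      cases hv with
      | tensor hv₁ hv₂ => rw [ih₁ (.value hv₁), ih₂ (.value hv₂)]
    | tensor h₁ h₂ => rw [ih₁ h₁, ih₂ h₂]
  | letStar _ _ ih₁ ih₂ =>
    cases h' with
    | value hv => cases hv
    | letStar h₁ h₂ => exact ih₂ h₂
  | letTensor _ _ ih₁ ih₂ =>
    cases h' with
    | value hv => cases hv
    | letTensor h₁ h₂ =>
      cases ih₁ h₁
      exact ih₂ h₂

/-- Determinism makes a term and its value interchangeable wherever only results of evaluation
matter. -/
theorem Eval.iff {M V : Tm S} (h : Eval M V) (W : Tm S) : Eval M W ↔ Eval V W := by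
  constructor
  · intro h'
    rw [← h.det h']
    exact h.self
  · intro h'
    rwa [h.isValue.eval_eq h']

theorem Eval.hasType {M V : Tm S} {τ : Ty} (h : Eval M V) (hM : HasType [] M τ) :
    HasType [] V τ := by
  induction h generalizing τ with
  | value => exact hM
  | op => cases hM; exact .const _
  | app _ _ _ ih₁ ih₂ ih₃ =>
    cases hM with
    | app h₁ h₂ hm _ =>
      obtain ⟨rfl, rfl⟩ := hm.eq_nil
      cases ih₁ h₁ with
      | lam hL => exact ih₃ (hL.subst (ih₂ h₂))
  | tensor _ _ ih₁ ih₂ =>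
    cases hM with
    | tensor h₁ h₂ hm hw =>
      obtain ⟨rfl, rfl⟩ := hm.eq_nil
      exact .tensor (ih₁ h₁) (ih₂ h₂) hm hw
  | letStar _ _ ih₁ ih₂ =>
    cases hM with
    | letStar h₁ h₂ hm _ =>
      obtain ⟨rfl, rfl⟩ := hm.eq_nil
      exact ih₂ h₂
  | letTensor _ _ ih₁ ih₂ =>
    cases hM with
    | letTensor h₁ h₂ hm _ =>
      obtain ⟨rfl, rfl⟩ := hm.eq_nil
      cases ih₁ h₁ with
      | tensor h₃ h₄ hm _ =>
        obtain ⟨rfl, rfl⟩ := hm.eq_nil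
        exact ih₂ (h₂.subst₂ h₃ h₄)

theorem Eval.isClosedValue {M V : Tm S} {τ : Ty} (h : Eval M V) (hM : HasType [] M τ) :
    IsClosedValue τ V :=
  ⟨h.isValue, h.hasType hM⟩

theorem Eval.app_arg_iff {F M V : Tm S} (h : Eval M V) (W : Tm S) :
    Eval (.app F M) W ↔ Eval (.app F V) W := by
  constructor
  all_goals
    intro h'
    cases h' with
    | value hv => cases hv
    | app h₁ h₂ h₃ => exact .app h₁ (by simpa [h.iff] using h₂) h₃

theorem Eval.app_lam_iff {x : Var} {τ : Ty} {L V : Tm S} (hV : IsValue V) (W : Tm S) :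
    Eval (.app (.lam x τ L) V) W ↔ Eval (L.subst x V) W := by
  constructor
  · intro h
    cases h with
    | value hv => cases hv
    | app h₁ h₂ h₃ =>
      cases h₁
      rwa [hV.eval_eq h₂] at h₃
  · exact fun h => .app (.value (.lam _ _ _)) (.value hV) h

/-! ### The logical relation -/

/-- Every clause of the relation inspects its two terms only through evaluation. -/
theorem LogRel.congr {τ : Ty} {r : ℝ≥0∞} {M M' N N' : Tm S} (hM : ∀ W, Eval M W ↔ Eval M' W)
    (hN : ∀ W, Eval N W ↔ Eval N' W) : LogRel τ r M N ↔ LogRel τ r M' N' := by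
  cases τ <;> simp only [LogRel, hM, hN]

theorem LogRel.eval_iff {τ : Ty} {r : ℝ≥0∞} {M N V U : Tm S} (hM : Eval M V) (hN : Eval N U) :
    LogRel τ r M N ↔ LogRel τ r V U :=
  LogRel.congr hM.iff hN.iff

theorem LogRel.exists_eval {τ : Ty} {r : ℝ≥0∞} {M N : Tm S} (h : LogRel τ r M N) :
    ∃ V U, Eval M V ∧ Eval N U := by
  cases τ with
  | real => obtain ⟨a, b, h₁, h₂, -⟩ := h; exact ⟨_, _, h₁, h₂⟩
  | unit => exact ⟨_, _, h⟩
  | tensor => obtain ⟨_, _, _, _, h₁, h₂, -⟩ := h; exact ⟨_, _, h₁, h₂⟩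
  | lolli => obtain ⟨_, _, _, _, h₁, h₂, -⟩ := h; exact ⟨_, _, h₁, h₂⟩

theorem LogRel.mono {τ : Ty} {r r' : ℝ≥0∞} {M N : Tm S} (h : LogRel τ r M N) (hr : r ≤ r') :
    LogRel τ r' M N := by
  induction τ generalizing r r' M N with
  | real => obtain ⟨a, b, h₁, h₂, h₃⟩ := h; exact ⟨a, b, h₁, h₂, h₃.trans hr⟩
  | unit => exact h
  | tensor =>
    obtain ⟨V, V', U, U', h₁, h₂, s, s', h₃, h₄, h₅⟩ := h
    exact ⟨V, V', U, U', h₁, h₂, s, s', h₃, h₄, h₅.trans hr⟩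
  | lolli τ σ _ ih =>
    obtain ⟨x, y, M', N', h₁, h₂, h₃⟩ := h
    exact ⟨x, y, M', N', h₁, h₂, fun V U s hV hU hVU =>
      ih (h₃ V U s hV hU hVU) (add_le_add_left hr s)⟩

/-- Substitutions that map every variable to itself or to a term without other free variables. -/
def Admissible (γ : Var → Tm S) : Prop :=
  ∀ x y V, x ≠ y → (γ x).subst y V = γ x

theorem admissible_var : Admissible (Tm.var : Var → Tm S) := fun x y V h => by
  simp [Tm.subst, h]

theorem Admissible.update {γ : Var → Tm S} (h : Admissible γ) {x : Var} {V : Tm S} {τ : Ty}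
    (hV : HasType [] V τ) : Admissible (Function.update γ x V) := by
  intro y z U hyz
  by_cases hy : y = x
  · subst hy; simpa using hV.subst_closed z U
  · simpa [hy] using h y z U hyz

theorem Admissible.subst_msub {γ : Var → Tm S} (h : Admissible γ) (M : Tm S) (x : Var)
    (V : Tm S) :
    (M.msub (Function.update γ x (.var x))).subst x V = M.msub (Function.update γ x V) :=
  Tm.subst_msub _ _ _ _ fun y hy => h y x V hy

/-- Two successive substitutions agree with the simultaneous one because `V` is closed, so the
second substitution leaves it unchanged. -/
theorem Admissible.subst_msub₂ {γ : Var → Tm S} (h : Admissible γ) (M : Tm S) {x y : Var}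
    (hxy : x ≠ y) {V : Tm S} {τ : Ty} (hV : HasType [] V τ) (U : Tm S) :
    ((M.msub (Function.update (Function.update γ x (.var x)) y (.var y))).subst x V).subst y U =
      M.msub (Function.update (Function.update γ x V) y U) := by
  rw [Function.update_comm hxy, Tm.subst_msub, Function.update_comm hxy.symm,
    (h.update hV).subst_msub]
  intro z hz
  by_cases hzy : z = y
  · subst hzy; simp [Tm.subst, hz]
  · simpa [hzy] using h z x V hz

/-- The sum of the weights of the variables of an environment. -/
def Env.weight (s : Var → ℝ≥0∞) (Γ : Env) : ℝ≥0∞ := (Γ.map fun p => s p.1).sum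

theorem Merge.weight {Γ Δ Ξ : Env} (h : Merge Γ Δ Ξ) (s : Var → ℝ≥0∞) :
    Ξ.weight s = Γ.weight s + Δ.weight s := by
  simp [Env.weight, (h.perm_append.map fun p => s p.1).sum_eq]

theorem MergeAll.weight {Γs : List Env} {Ξ : Env} (h : MergeAll Γs Ξ) (s : Var → ℝ≥0∞) :
    Ξ.weight s = (Γs.map (Env.weight s)).sum := by
  induction h with
  | nil => rfl
  | cons _ hm ih => simp [hm.weight, ih]

theorem Env.weight_update {Γ : Env} {x : Var} {σ : Ty} (h : Env.WF ((x, σ) :: Γ))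
    (s : Var → ℝ≥0∞) (t : ℝ≥0∞) : Γ.weight (Function.update s x t) = Γ.weight s := by
  unfold Env.weight
  congr 1
  exact List.map_congr_left fun q hq => by simp [h.ne (ρ := q.2) hq]

/-- `γ` and `γ'` are closing substitutions for `Γ`, and the distance of `γ x` and `γ' x` is at
most `s x`. -/
structure RelEnv (Γ : Env) (s : Var → ℝ≥0∞) (γ γ' : Var → Tm S) : Prop where
  adm : Admissible γ
  adm' : Admissible γ'
  closed : ∀ x σ, (x, σ) ∈ Γ → IsClosedValue σ (γ x)
  closed' : ∀ x σ, (x, σ) ∈ Γ → IsClosedValue σ (γ' x)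
  rel : ∀ x σ, (x, σ) ∈ Γ → LogRel σ (s x) (γ x) (γ' x)

theorem RelEnv.sub {Γ Δ : Env} {s : Var → ℝ≥0∞} {γ γ' : Var → Tm S} (h : RelEnv Δ s γ γ')
    (hs : ∀ p, p ∈ Γ → p ∈ Δ) : RelEnv Γ s γ γ' :=
  ⟨h.adm, h.adm', fun x σ hx => h.closed x σ (hs _ hx), fun x σ hx => h.closed' x σ (hs _ hx),
    fun x σ hx => h.rel x σ (hs _ hx)⟩

theorem relEnv_nil (s : Var → ℝ≥0∞) : RelEnv [] s (Tm.var : Var → Tm S) Tm.var :=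
  ⟨admissible_var, admissible_var, by simp, by simp, by simp⟩

theorem RelEnv.update {Γ : Env} {s : Var → ℝ≥0∞} {γ γ' : Var → Tm S} (h : RelEnv Γ s γ γ')
    {x : Var} {σ : Ty} (hw : Env.WF ((x, σ) :: Γ)) {V U : Tm S} {t : ℝ≥0∞}
    (hV : IsClosedValue σ V) (hU : IsClosedValue σ U) (hVU : LogRel σ t V U) :
    RelEnv ((x, σ) :: Γ) (Function.update s x t) (Function.update γ x V)
      (Function.update γ' x U) := by
  refine ⟨h.adm.update hV.2, h.adm'.update hU.2, ?_, ?_, ?_⟩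
  all_goals
    intro y ρ hy
    rcases List.mem_cons.1 hy with hy | hy
    · cases hy; simpa
  · simpa [hw.ne hy] using h.closed y ρ hy
  · simpa [hw.ne hy] using h.closed' y ρ hy
  · simpa [hw.ne hy] using h.rel y ρ hy

/-- The logical relation on open terms of type `τ` in the environment `Γ`. -/
structure OpenRel (Γ : Env) (τ : Ty) (r : ℝ≥0∞) (M N : Tm S) : Prop where
  left : HasType Γ M τ
  right : HasType Γ N τ
  rel : ∀ s γ γ', RelEnv Γ s γ γ' → LogRel τ (r + Γ.weight s) (M.msub γ) (N.msub γ')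

theorem OpenRel.perm {Γ Δ : Env} {τ : Ty} {r : ℝ≥0∞} {M N : Tm S} (h : OpenRel Γ τ r M N)
    (hp : Γ.Perm Δ) : OpenRel Δ τ r M N := by
  refine ⟨h.left.exchange hp, h.right.exchange hp, fun s γ γ' hγ => ?_⟩
  have := h.rel s γ γ' (hγ.sub fun _ => hp.mem_iff.1)
  rwa [Env.weight, (hp.map fun p => s p.1).sum_eq] at this

theorem openRel_nil_iff {τ : Ty} {r : ℝ≥0∞} {M N : Tm S} (hM : HasType [] M τ)
    (hN : HasType [] N τ) : OpenRel [] τ r M N ↔ LogRel τ r M N := by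
  constructor
  · intro h
    simpa [hM.msub_closed, hN.msub_closed, Env.weight] using h.rel 0 _ _ (relEnv_nil 0)
  · intro h
    exact ⟨hM, hN, fun s γ γ' _ => by
      simpa [hM.msub_closed, hN.msub_closed, Env.weight] using h⟩

theorem OpenRel.logRel {τ : Ty} {r : ℝ≥0∞} {M N : Tm S} (h : OpenRel [] τ r M N) :
    LogRel τ r M N :=
  (openRel_nil_iff h.left h.right).1 h

theorem RelEnv.hasType {Γ : Env} {s : Var → ℝ≥0∞} {γ γ' : Var → Tm S} (h : RelEnv Γ s γ γ')
    {M : Tm S} {τ : Ty} (hM : HasType Γ M τ) : HasType [] (M.msub γ) τ :=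
  hM.msub γ fun x σ hx => (h.closed x σ hx).2

theorem RelEnv.hasType' {Γ : Env} {s : Var → ℝ≥0∞} {γ γ' : Var → Tm S} (h : RelEnv Γ s γ γ')
    {M : Tm S} {τ : Ty} (hM : HasType Γ M τ) : HasType [] (M.msub γ') τ :=
  hM.msub γ' fun x σ hx => (h.closed' x σ hx).2

/-! ### Compatibility of the open relation with the term formers -/

theorem OpenRel.var (x : Var) (τ : Ty) : OpenRel (S := S) [(x, τ)] τ 0 (.var x) (.var x) :=
  ⟨.var x τ, .var x τ, fun s γ γ' h => by
    simpa [Env.weight, Tm.msub] using h.rel x τ (by simp)⟩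

theorem OpenRel.const (a : ℝ) : OpenRel (S := S) [] .real 0 (.const a) (.const a) :=
  (openRel_nil_iff (.const a) (.const a)).2 ⟨a, a, .value (.const a), .value (.const a), by simp⟩

theorem OpenRel.star : OpenRel (S := S) [] .unit 0 .star .star :=
  (openRel_nil_iff .star .star).2 ⟨.value .star, .value .star⟩

theorem OpenRel.op (f : S) {Γ : Fin f.1.arity → Env} {M N : Fin f.1.arity → Tm S}
    {r : Fin f.1.arity → ℝ≥0∞} {Ξ : Env} (h : ∀ i, OpenRel (Γ i) .real (r i) (M i) (N i))
    (hm : MergeAll (List.ofFn Γ) Ξ) (hw : Ξ.WF) :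
    OpenRel Ξ .real (∑ i, r i) (.op f M) (.op f N) := by
  refine ⟨.op f Γ M (fun i => (h i).left) hm hw, .op f Γ N (fun i => (h i).right) hm hw,
    fun s γ γ' hγ => ?_⟩
  have := fun i => (h i).rel s γ γ' (hγ.sub fun p hp => hm.mem hp)
  choose a b ha hb hab using this
  refine ⟨_, _, .op f _ a ha, .op f _ b hb, ?_⟩
  -- Non-expansiveness for the sum of the distances is exactly what lets the radii and weights of
  -- the arguments add up.
  calc ENNReal.ofReal |f.1.toFun a - f.1.toFun b|
      ≤ ENNReal.ofReal (∑ i, |a i - b i|) := ENNReal.ofReal_le_ofReal (f.1.nonexp a b)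
    _ = ∑ i, ENNReal.ofReal |a i - b i| :=
        ENNReal.ofReal_sum_of_nonneg fun i _ => abs_nonneg _
    _ ≤ ∑ i, (r i + (Γ i).weight s) := Finset.sum_le_sum fun i _ => hab i
    _ = ∑ i, r i + Ξ.weight s := by
        rw [Finset.sum_add_distrib, hm.weight, List.map_ofFn, List.sum_ofFn]
        rfl

theorem OpenRel.lam {Γ : Env} {x : Var} {σ τ : Ty} {r : ℝ≥0∞} {M N : Tm S}
    (h : OpenRel ((x, σ) :: Γ) τ r M N) :
    OpenRel Γ (.lolli σ τ) r (.lam x σ M) (.lam x σ N) := by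
  refine ⟨.lam h.left, .lam h.right, fun s γ γ' hγ => ?_⟩
  refine ⟨x, x, _, _, .value (.lam _ _ _), .value (.lam _ _ _), fun V U t hV hU hVU => ?_⟩
  rw [hγ.adm.subst_msub, hγ.adm'.subst_msub]
  have := h.rel _ _ _ (hγ.update h.left.wf hV hU hVU)
  convert this using 1
  have hw := Env.weight_update h.left.wf s t
  rw [Env.weight] at hw
  simp only [Env.weight, List.map_cons, List.sum_cons, Function.update_self, hw]
  rw [add_assoc, add_comm t]

theorem OpenRel.app {Γ Δ Ξ : Env} {σ τ : Ty} {r r' : ℝ≥0∞} {M M' N N' : Tm S}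
    (h : OpenRel Γ (.lolli σ τ) r M M') (h' : OpenRel Δ σ r' N N') (hm : Merge Γ Δ Ξ)
    (hw : Ξ.WF) : OpenRel Ξ τ (r + r') (.app M N) (.app M' N') := by
  refine ⟨.app h.left h'.left hm hw, .app h.right h'.right hm hw, fun s γ γ' hγ => ?_⟩
  have hΔ := hγ.sub fun p => hm.mem_right (p := p)
  obtain ⟨x, y, L, L', e₁, e₂, hL⟩ := h.rel s γ γ' (hγ.sub fun p => hm.mem_left (p := p))
  have hN := h'.rel s γ γ' hΔ
  obtain ⟨V, U, hV, hU⟩ := hN.exists_eval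
  have hLVU := hL V U _ (hV.isClosedValue (hΔ.hasType h'.left))
    (hU.isClosedValue (hΔ.hasType' h'.right)) ((LogRel.eval_iff hV hU).1 hN)
  obtain ⟨W, W', hW, hW'⟩ := hLVU.exists_eval
  rw [LogRel.eval_iff hW hW'] at hLVU
  rw [Tm.msub, Tm.msub, LogRel.eval_iff (.app e₁ hV hW) (.app e₂ hU hW'), hm.weight s,
    add_add_add_comm]
  exact hLVU

theorem OpenRel.tensor {Γ Δ Ξ : Env} {σ τ : Ty} {r r' : ℝ≥0∞} {M M' N N' : Tm S}
    (h : OpenRel Γ τ r M M') (h' : OpenRel Δ σ r' N N') (hm : Merge Γ Δ Ξ)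
    (hw : Ξ.WF) : OpenRel Ξ (.tensor τ σ) (r + r') (.tensor M N) (.tensor M' N') := by
  refine ⟨.tensor h.left h'.left hm hw, .tensor h.right h'.right hm hw, fun s γ γ' hγ => ?_⟩
  have hM := h.rel s γ γ' (hγ.sub fun p => hm.mem_left (p := p))
  have hN := h'.rel s γ γ' (hγ.sub fun p => hm.mem_right (p := p))
  obtain ⟨V, U, hV, hU⟩ := hM.exists_eval
  obtain ⟨V', U', hV', hU'⟩ := hN.exists_eval
  refine ⟨_, _, _, _, .tensor hV hV', .tensor hU hU', _, _, (LogRel.eval_iff hV hU).1 hM,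
    (LogRel.eval_iff hV' hU').1 hN, ?_⟩
  rw [hm.weight s, add_add_add_comm]

theorem OpenRel.letStar {Γ Δ Ξ : Env} {τ : Ty} {r r' : ℝ≥0∞} {M M' N N' : Tm S}
    (h : OpenRel Γ .unit r M M') (h' : OpenRel Δ τ r' N N') (hm : Merge Γ Δ Ξ)
    (hw : Ξ.WF) : OpenRel Ξ τ (r + r') (.letStar M N) (.letStar M' N') := by
  refine ⟨.letStar h.left h'.left hm hw, .letStar h.right h'.right hm hw, fun s γ γ' hγ => ?_⟩
  obtain ⟨hM, hM'⟩ := h.rel s γ γ' (hγ.sub fun p => hm.mem_left (p := p))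
  have hN := h'.rel s γ γ' (hγ.sub fun p => hm.mem_right (p := p))
  obtain ⟨V, U, hV, hU⟩ := hN.exists_eval
  rw [LogRel.eval_iff hV hU] at hN
  rw [Tm.msub, Tm.msub, LogRel.eval_iff (.letStar hM hV) (.letStar hM' hU)]
  -- Values of type `I` carry no information, so the radius spent on the first component is given
  -- away.
  refine hN.mono ?_
  rw [hm.weight s, add_add_add_comm]
  exact le_add_self

theorem OpenRel.letTensor {Γ Δ Ξ : Env} {x y : Var} {σ₁ σ₂ τ : Ty} {r r' : ℝ≥0∞}
    {M M' N N' : Tm S} (h : OpenRel Γ (.tensor σ₁ σ₂) r M M')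
    (h' : OpenRel ((y, σ₂) :: (x, σ₁) :: Δ) τ r' N N') (hm : Merge Γ Δ Ξ) (hw : Ξ.WF) :
    OpenRel Ξ τ (r + r') (.letTensor x y M N) (.letTensor x y M' N') := by
  refine ⟨.letTensor h.left h'.left hm hw, .letTensor h.right h'.right hm hw,
    fun s γ γ' hγ => ?_⟩
  have hΓ := hγ.sub fun p => hm.mem_left (p := p)
  have hΔ := hγ.sub fun p => hm.mem_right (p := p)
  have hwf := h'.left.wf
  have hxy : x ≠ y := hwf.ne List.mem_cons_self
  obtain ⟨V, V', U, U', e₁, e₂, t, t', hVU, hVU', ht⟩ := h.rel s γ γ' hΓ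
  obtain ⟨hvV, hvV'⟩ : IsClosedValue σ₁ V ∧ IsClosedValue σ₂ V' := by
    obtain ⟨hv, ht⟩ := e₁.isClosedValue (hΓ.hasType h.left)
    cases hv with
    | tensor hv₁ hv₂ =>
      cases ht with
      | tensor ht₁ ht₂ hm _ =>
        obtain ⟨rfl, rfl⟩ := hm.eq_nil
        exact ⟨⟨hv₁, ht₁⟩, ⟨hv₂, ht₂⟩⟩
  obtain ⟨hvU, hvU'⟩ : IsClosedValue σ₁ U ∧ IsClosedValue σ₂ U' := by
    obtain ⟨hv, ht⟩ := e₂.isClosedValue (hΓ.hasType' h.right)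
    cases hv with
    | tensor hv₁ hv₂ =>
      cases ht with
      | tensor ht₁ ht₂ hm _ =>
        obtain ⟨rfl, rfl⟩ := hm.eq_nil
        exact ⟨⟨hv₁, ht₁⟩, ⟨hv₂, ht₂⟩⟩
  have hN := h'.rel _ _ _ ((hΔ.update hwf.tail hvV hvU hVU).update hwf hvV' hvU' hVU')
  rw [← hγ.adm.subst_msub₂ N hxy hvV.2 V', ← hγ.adm'.subst_msub₂ N' hxy hvU.2 U'] at hN
  obtain ⟨W, W', hW, hW'⟩ := hN.exists_eval
  rw [LogRel.eval_iff hW hW'] at hN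
  rw [Tm.msub, Tm.msub, LogRel.eval_iff (.letTensor e₁ hW) (.letTensor e₂ hW')]
  refine hN.mono ?_
  have h₁ := Env.weight_update hwf (Function.update s x t) t'
  have h₂ := Env.weight_update hwf.tail s t
  simp only [Env.weight, List.map_cons, List.sum_cons, Function.update_self] at h₁ h₂
  simp only [Env.weight, List.map_cons, List.sum_cons, Function.update_self, h₁, h₂]
  have h₃ := hm.weight s
  simp only [Env.weight] at h₃ ht
  rw [h₃]
  -- The two components of the pair consume `t` and `t'`, and `t + t'` is within the radius of the
  -- pair, namely `r` plus the weight of `Γ`.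
  calc _ = r' + ((t + t') + (Δ.map fun p => s p.1).sum) := by ring
    _ ≤ r' + ((r + (Γ.map fun p => s p.1).sum) + (Δ.map fun p => s p.1).sum) := by gcongr
    _ = _ := by ring

/-- The fundamental lemma: every definable map is non-expansive. As the relation contains
convergence, it also yields termination of closed terms. -/
theorem HasType.openRel {Γ : Env} {M : Tm S} {τ : Ty} (h : HasType Γ M τ) :
    OpenRel Γ τ 0 M M := by
  induction h with
  | var x τ => exact .var x τ
  | const a => exact .const a
  | star => exact .star
  | op f Γ M _ hm hw ih => simpa using OpenRel.op f ih hm hw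
  | lam _ ih => exact ih.lam
  | app _ _ hm hw ih₁ ih₂ => simpa using ih₁.app ih₂ hm hw
  | tensor _ _ hm hw ih₁ ih₂ => simpa using ih₁.tensor ih₂ hm hw
  | letStar _ _ hm hw ih₁ ih₂ => simpa using ih₁.letStar ih₂ hm hw
  | letTensor _ _ hm hw ih₁ ih₂ => simpa using ih₁.letTensor ih₂ hm hw

theorem HasType.exists_eval {M : Tm S} {τ : Ty} (h : HasType [] M τ) : ∃ V, Eval M V :=
  let ⟨V, _, hV, _⟩ := h.openRel.logRel.exists_eval
  ⟨V, hV⟩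

/-! ### Contexts -/

/-- A derivation for `C.plug P` assigns some environment and type to the hole. By `hP` these can
only be `Γ`, up to order, and `τ`, so `M` and `N` may replace `P` in that derivation; all other
subterms are at distance `0` from themselves. -/
theorem OpenRel.plug {Γ : Env} {τ : Ty} {r : ℝ≥0∞} {P M N : Tm S} (h : OpenRel Γ τ r M N)
    (hP : ∀ Δ σ, HasType Δ P σ → Δ.Perm Γ ∧ σ = τ) (C : Cxt S) {Δ : Env} {σ : Ty}
    (hC : HasType Δ (C.plug P) σ) : OpenRel Δ σ r (C.plug M) (C.plug N) := by
  induction C generalizing Δ σ with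
  | hole =>
    obtain ⟨hp, rfl⟩ := hP _ _ hC
    exact h.perm hp.symm
  | op f i L C ih =>
    cases hC with
    | op _ Γ _ hL hm hw =>
      -- Only the argument containing the hole contributes to the radius, so the sum of the
      -- `Pi.single i r` is `r`.
      have := OpenRel.op f (Γ := Γ) (M := Function.update L i (C.plug M))
        (N := Function.update L i (C.plug N)) (r := Pi.single i r) (fun j => ?_) hm hw
      · simpa [Cxt.plug] using this
      · have hj := hL j
        by_cases hji : j = i
        · subst hji
          simp only [Function.update_self, Pi.single_eq_same] at hj ⊢
          exact ih hj
        · simp only [Function.update_of_ne hji, Pi.single_eq_of_ne hji] at hj ⊢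
          exact hj.openRel
  | appL C L ih =>
    cases hC with
    | app h₁ h₂ hm hw => simpa [Cxt.plug] using (ih h₁).app h₂.openRel hm hw
  | appR L C ih =>
    cases hC with
    | app h₁ h₂ hm hw => simpa [Cxt.plug] using h₁.openRel.app (ih h₂) hm hw
  | lam x σ C ih =>
    cases hC with
    | lam h₁ => exact (ih h₁).lam
  | tensorL C L ih =>
    cases hC with
    | tensor h₁ h₂ hm hw => simpa [Cxt.plug] using (ih h₁).tensor h₂.openRel hm hw
  | tensorR L C ih =>
    cases hC with
    | tensor h₁ h₂ hm hw => simpa [Cxt.plug] using h₁.openRel.tensor (ih h₂) hm hw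
  | letStarL C L ih =>
    cases hC with
    | letStar h₁ h₂ hm hw => simpa [Cxt.plug] using (ih h₁).letStar h₂.openRel hm hw
  | letStarR L C ih =>
    cases hC with
    | letStar h₁ h₂ hm hw => simpa [Cxt.plug] using h₁.openRel.letStar (ih h₂) hm hw
  | letTensorL x y C L ih =>
    cases hC with
    | letTensor h₁ h₂ hm hw => simpa [Cxt.plug] using (ih h₁).letTensor h₂.openRel hm hw
  | letTensorR x y L C ih =>
    cases hC with
    | letTensor h₁ h₂ hm hw => simpa [Cxt.plug] using h₁.openRel.letTensor (ih h₂) hm hw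

/-- For `Γ = (x : σ, …, y : ρ)`, the term `(λz:σ ⊸ ⋯ ⊸ τ. z) (λx:σ. ⋯ λy:ρ. M) x ⋯ y`. It has only
one type, and only in the permutations of `Γ`. -/
def Tm.pin : Env → Ty → Tm S → Tm S
  | [], τ, M => .app (.lam 0 τ (.var 0)) M
  | (y, ρ) :: Γ, τ, M => .app (Tm.pin Γ (.lolli ρ τ) (.lam y ρ M)) (.var y)

theorem HasType.id (τ : Ty) : HasType (S := S) [] (.lam 0 τ (.var 0)) (.lolli τ τ) :=
  .lam (.var 0 τ)

theorem HasType.pin {Γ : Env} {M : Tm S} {τ : Ty} (h : HasType Γ M τ) :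
    HasType Γ (M.pin Γ τ) τ := by
  induction Γ generalizing M τ with
  | nil => exact .app (.id τ) h .nil Env.wf_nil
  | cons p Γ ih => exact .app (ih (.lam h)) (.var _ _) (.right p (.nil_right Γ)) h.wf

/-- A term need not determine its typing: a variable can be given any type. In the pinned term the
annotations of the λ-abstractions fix the type of each variable of `Γ`, and the annotated identity
fixes the result type. -/
theorem HasType.pin_unique {Γ : Env} {M : Tm S} {τ : Ty} (h : HasType Γ M τ) {Δ : Env} {σ : Ty}
    (hP : HasType Δ (M.pin Γ τ) σ) : Δ.Perm Γ ∧ σ = τ := by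
  induction Γ generalizing M τ Δ σ with
  | nil =>
    cases hP with
    | @app Γ₁ Γ₂ _ _ _ _ _ h₁ h₂ hm _ =>
      -- A variable of `Γ₂` would have to occur free in `M`, which is closed.
      have hΓ₂ : Γ₂ = [] := List.eq_nil_iff_forall_not_mem.2 fun q hq =>
        h.not_free q.1 ((h₂.free_iff q.1).2 ⟨q.2, hq⟩)
      subst hΓ₂
      have hp := hm.perm_append
      cases h₁ with
      | lam h₁ =>
        cases h₁
        exact ⟨by simpa using hp, rfl⟩
  | cons p Γ ih =>
    cases hP with
    | app h₁ h₂ hm _ =>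
      obtain ⟨hp, he⟩ := ih (.lam h) h₁
      cases he
      cases h₂
      exact ⟨(hm.perm_append.trans List.perm_append_comm).trans (hp.cons _), rfl⟩

theorem HasType.close {Γ : Env} {M : Tm S} {τ : Ty} (h : HasType Γ M τ) :
    HasType [] (Γ.close M) (Γ.closeTy τ) := by
  induction Γ generalizing M τ with
  | nil => exact h
  | cons p Γ ih => exact ih (.lam h)

theorem openRel_of_close {Γ : Env} {M N : Tm S} {τ : Ty} {r : ℝ≥0∞} (hM : HasType Γ M τ)
    (hN : HasType Γ N τ) (h : LogRel (Γ.closeTy τ) r (Γ.close M) (Γ.close N)) :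
    OpenRel Γ τ r M N := by
  induction Γ generalizing M N τ with
  | nil => exact (openRel_nil_iff hM hN).2 h
  | cons p Γ ih =>
    obtain ⟨x, σ⟩ := p
    refine ⟨hM, hN, fun s γ γ' hγ => ?_⟩
    obtain ⟨y, z, M', N', e₁, e₂, hMN⟩ := (ih (.lam hM) (.lam hN) h).rel s γ γ'
      (hγ.sub fun p hp => List.mem_cons_of_mem _ hp)
    cases e₁
    cases e₂
    have hx : (x, σ) ∈ (x, σ) :: Γ := List.mem_cons_self
    -- Feeding the values `γ x` and `γ' x` to the outermost λ restores the full substitutions, and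
    -- `s x` restores the full weight.
    have := hMN _ _ (s x) (hγ.closed _ _ hx) (hγ.closed' _ _ hx) (hγ.rel _ _ hx)
    rw [hγ.adm.subst_msub, hγ.adm'.subst_msub, Function.update_eq_self,
      Function.update_eq_self] at this
    convert this using 1
    simp only [Env.weight, List.map_cons, List.sum_cons]
    rw [add_assoc, add_comm (s x)]

/-! ### Tuples of numerals and the bound `dObs ≤ dLog` -/

theorem isValue_tuple : ∀ (n : ℕ) (a : Fin n → ℝ), IsValue (Tm.tuple n a : Tm S)
  | 0, _ => .star
  | 1, _ => .const _
  | n + 2, _ => .tensor (isValue_tuple (n + 1) _) (.const _)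

theorem LogRel.tuple_le : ∀ (n : ℕ) (a b : Fin n → ℝ) (r : ℝ≥0∞),
    LogRel (S := S) (Ty.rpow n) r (Tm.tuple n a) (Tm.tuple n b) →
      ENNReal.ofReal (∑ i, |a i - b i|) ≤ r
  | 0, _, _, _, _ => by simp
  | 1, a, b, r, h => by
    obtain ⟨a', b', h₁, h₂, h₃⟩ := h
    cases h₁
    cases h₂
    simpa using h₃
  | n + 2, a, b, r, h => by
    obtain ⟨V, V', U, U', h₁, h₂, s, s', h₃, h₄, h₅⟩ := h
    cases (isValue_tuple (n + 2) a).eval_eq h₁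
    cases (isValue_tuple (n + 2) b).eval_eq h₂
    obtain ⟨a', b', h₁, h₂, h₆⟩ := h₄
    cases h₁
    cases h₂
    rw [Fin.sum_univ_castSucc, ENNReal.ofReal_add (Finset.sum_nonneg fun _ _ => abs_nonneg _)
      (abs_nonneg _)]
    exact (add_le_add (LogRel.tuple_le (n + 1) _ _ s h₃) h₆).trans h₅

theorem dObs_le_dLog (S : Set NonExp) (Γ : Env) (τ : Ty) (M N : Term S Γ τ) :
    dObs S Γ τ M N ≤ dLog S Γ τ M N := by
  refine sSup_le ?_
  rintro _ ⟨n, σ, C, hC, a, b, V, U, hV, hU, rfl⟩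
  refine le_sInf fun r hr => ?_
  -- The pinned form of `M` reveals the typing at the hole; the relation is then transported for `M`
  -- and `N` themselves.
  have h := (openRel_of_close M.2 N.2 hr).plug (fun _ _ => M.2.pin_unique) C (hC _ M.2.pin)
  obtain ⟨W, W', Z, Z', h₁, h₂, s, s', h₃, -, h₄⟩ := h.logRel
  cases hV.det h₁
  cases hU.det h₂
  exact (LogRel.tuple_le n a b s h₃).trans (le_self_add.trans h₄)

/-! ### Closed values -/

theorem IsClosedValue.eval {τ : Ty} {V : Tm S} (h : IsClosedValue τ V) : Eval V V := .value h.1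

theorem IsClosedValue.tensor {τ σ : Ty} {V U : Tm S} (h : IsClosedValue τ V)
    (h' : IsClosedValue σ U) : IsClosedValue (.tensor τ σ) (.tensor V U) :=
  ⟨.tensor h.1 h'.1, .tensor h.2 h'.2 .nil Env.wf_nil⟩

theorem isClosedValue_const (a : ℝ) : IsClosedValue (S := S) .real (.const a) :=
  ⟨.const a, .const a⟩

theorem isClosedValue_star : IsClosedValue (S := S) .unit .star :=
  ⟨.star, .star⟩

theorem isClosedValue_tuple : ∀ (n : ℕ) (a : Fin n → ℝ),
    IsClosedValue (S := S) (Ty.rpow n) (Tm.tuple n a)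
  | 0, _ => isClosedValue_star
  | 1, _ => isClosedValue_const _
  | n + 2, _ => (isClosedValue_tuple (n + 1) _).tensor (isClosedValue_const _)

theorem IsClosedValue.exists_const {V : Tm S} (h : IsClosedValue .real V) :
    ∃ a, V = .const a := by
  obtain ⟨hv, ht⟩ := h
  cases hv <;> cases ht
  exact ⟨_, rfl⟩

theorem IsClosedValue.eq_star {V : Tm S} (h : IsClosedValue .unit V) : V = .star := by
  obtain ⟨hv, ht⟩ := h
  cases hv <;> cases ht
  rfl

theorem IsClosedValue.exists_lam {τ σ : Ty} {V : Tm S} (h : IsClosedValue (.lolli τ σ) V) :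
    ∃ x L, V = .lam x τ L ∧ HasType [(x, τ)] L σ := by
  obtain ⟨hv, ht⟩ := h
  cases hv <;> cases ht
  exact ⟨_, _, rfl, by assumption⟩

theorem IsClosedValue.exists_tensor {τ σ : Ty} {V : Tm S} (h : IsClosedValue (.tensor τ σ) V) :
    ∃ V₁ V₂, V = .tensor V₁ V₂ ∧ IsClosedValue τ V₁ ∧ IsClosedValue σ V₂ := by
  obtain ⟨hv, ht⟩ := h
  cases hv with
  | tensor hv₁ hv₂ =>
    cases ht with
    | tensor ht₁ ht₂ hm _ =>
      obtain ⟨rfl, rfl⟩ := hm.eq_nil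
      exact ⟨_, _, rfl, ⟨hv₁, ht₁⟩, ⟨hv₂, ht₂⟩⟩
  | _ => cases ht

/-! ### The first-order distance of values -/

/-- The sum of the distances of the corresponding numerals of two values of the same type,
where functions are ignored. -/
noncomputable def outDist : Tm S → Tm S → ℝ≥0∞
  | .const a, .const b => ENNReal.ofReal |a - b|
  | .tensor V V', .tensor U U' => outDist V U + outDist V' U'
  | _, _ => 0

/-- The common type gives the three values the same first-order shape, so the comparison is numeral
by numeral. -/
theorem outDist_triangle {τ : Ty} {V W U : Tm S} (hV : IsClosedValue τ V)
    (hW : IsClosedValue τ W) (hU : IsClosedValue τ U) :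
    outDist V U ≤ outDist V W + outDist W U := by
  induction τ generalizing V W U with
  | real =>
    obtain ⟨a, rfl⟩ := hV.exists_const
    obtain ⟨b, rfl⟩ := hW.exists_const
    obtain ⟨c, rfl⟩ := hU.exists_const
    simp only [outDist]
    rw [← ENNReal.ofReal_add (abs_nonneg _) (abs_nonneg _)]
    exact ENNReal.ofReal_le_ofReal (abs_sub_le a b c)
  | unit =>
    rw [hV.eq_star, hU.eq_star]
    simp [outDist]
  | lolli =>
    obtain ⟨_, _, rfl, -⟩ := hV.exists_lam
    simp [outDist]
  | tensor τ σ ih₁ ih₂ =>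
    obtain ⟨V₁, V₂, rfl, h₁, h₂⟩ := hV.exists_tensor
    obtain ⟨W₁, W₂, rfl, h₃, h₄⟩ := hW.exists_tensor
    obtain ⟨U₁, U₂, rfl, h₅, h₆⟩ := hU.exists_tensor
    simp only [outDist]
    rw [add_add_add_comm]
    exact add_le_add (ih₁ h₁ h₃ h₅) (ih₂ h₂ h₄ h₆)

theorem LogRel.outDist_le {τ : Ty} {r : ℝ≥0∞} {V U : Tm S} (h : LogRel τ r V U)
    (hV : IsClosedValue τ V) (hU : IsClosedValue τ U) : outDist V U ≤ r := by
  induction τ generalizing r V U with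
  | real =>
    obtain ⟨a, b, h₁, h₂, h₃⟩ := h
    cases hV.1.eval_eq h₁
    cases hU.1.eval_eq h₂
    exact h₃
  | unit =>
    rw [hV.eq_star]
    simp [outDist]
  | lolli =>
    obtain ⟨_, _, rfl, -⟩ := hV.exists_lam
    simp [outDist]
  | tensor τ σ ih₁ ih₂ =>
    obtain ⟨V₁, V₂, rfl, h₁, h₂⟩ := hV.exists_tensor
    obtain ⟨U₁, U₂, rfl, h₃, h₄⟩ := hU.exists_tensor
    obtain ⟨_, _, _, _, e₁, e₂, s, s', h₅, h₆, h₇⟩ := h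
    cases hV.1.eval_eq e₁
    cases hU.1.eval_eq e₂
    exact (add_le_add (ih₁ h₅ h₁ h₃) (ih₂ h₆ h₂ h₄)).trans h₇

/-! ### Applicative tests -/

/-- Some closed function of type `τ ⊸ σ` maps `M` to `V` and `N` to `U`. -/
def Conv (τ : Ty) (M N : Tm S) (σ : Ty) (V U : Tm S) : Prop :=
  ∃ F : Tm S, HasType [] F (.lolli τ σ) ∧ Eval (.app F M) V ∧ Eval (.app F N) U

theorem Conv.eval_iff {τ σ : Ty} {M N V U A B : Tm S} (hM : Eval M V) (hN : Eval N U) :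
    Conv τ M N σ A B ↔ Conv τ V U σ A B := by
  simp only [Conv, hM.app_arg_iff, hN.app_arg_iff]

theorem Conv.of_forall {τ σ : Ty} {V U A B : Tm S} {x : Var} {L : Tm S}
    (hL : HasType [(x, τ)] L σ) (hV : IsValue V) (hU : IsValue U)
    (hA : Eval (L.subst x V) A) (hB : Eval (L.subst x U) B) : Conv τ V U σ A B :=
  ⟨_, .lam hL, (Eval.app_lam_iff hV _).2 hA, (Eval.app_lam_iff hU _).2 hB⟩

theorem Conv.refl {τ : Ty} {M N V U : Tm S} (hM : Eval M V) (hN : Eval N U) :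
    Conv τ M N τ V U :=
  (Conv.eval_iff hM hN).2 <| .of_forall (x := 0) (.var 0 τ) hM.isValue hN.isValue
    (by simpa [Tm.subst] using hM.self) (by simpa [Tm.subst] using hN.self)

theorem Eval.exists_of_app {F M A : Tm S} (h : Eval (.app F M) A) : ∃ V, Eval M V := by
  cases h with
  | value hv => cases hv
  | app _ h _ => exact ⟨_, h⟩

/-- Tests compose: the composite is `λz. G (F z)`. -/
theorem Conv.trans {τ σ ρ : Ty} {M N V U A B : Tm S} (h : Conv τ M N σ V U)
    (h' : Conv σ V U ρ A B) : Conv τ M N ρ A B := by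
  obtain ⟨F, hF, hV, hU⟩ := h
  obtain ⟨G, hG, hA, hB⟩ := h'
  obtain ⟨V', hM⟩ := hV.exists_of_app
  obtain ⟨U', hN⟩ := hU.exists_of_app
  rw [Conv.eval_iff hM hN]
  rw [hM.app_arg_iff] at hV
  rw [hN.app_arg_iff] at hU
  refine .of_forall (x := 0) (L := .app G (.app F (.var 0)))
    (.app hG (.app hF (.var 0 τ) (.nil_left _) (by simp [Env.WF])) (.nil_left _)
      (by simp [Env.WF])) hM.isValue hN.isValue ?_ ?_
  · simpa [Tm.subst, hF.subst_closed, hG.subst_closed, hV.app_arg_iff] using hA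
  · simpa [Tm.subst, hF.subst_closed, hG.subst_closed, hU.app_arg_iff] using hB

/-- A pair can be taken apart linearly and each component given to its own test. This makes the
distances achieved on the components add. -/
theorem Conv.tensor {τ τ' σ σ' : Ty} {V V' U U' A A' B B' : Tm S}
    (hV : IsClosedValue τ V) (hV' : IsClosedValue τ' V') (hU : IsClosedValue τ U)
    (hU' : IsClosedValue τ' U') (h : Conv τ V U σ A B) (h' : Conv τ' V' U' σ' A' B') :
    Conv (.tensor τ τ') (.tensor V V') (.tensor U U') (.tensor σ σ') (.tensor A A')
      (.tensor B B') := by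
  obtain ⟨F, hF, hA, hB⟩ := h
  obtain ⟨G, hG, hA', hB'⟩ := h'
  refine .of_forall (x := 0)
    (L := .letTensor 1 2 (.var 0) (.tensor (.app F (.var 1)) (.app G (.var 2))))
    (.letTensor (.var 0 _) (.tensor (Γ := [(1, τ)]) (Δ := [(2, τ')])
      (.app hF (.var 1 _) (.nil_left _) (by simp [Env.WF]))
      (.app hG (.var 2 _) (.nil_left _) (by simp [Env.WF]))
      (.right _ (.left _ .nil)) (by simp [Env.WF])) (.nil_right _) (by simp [Env.WF]))
    (.tensor hV.1 hV'.1) (.tensor hU.1 hU'.1) ?_ ?_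
  · refine .letTensor (V := V) (U := V') ?_ ?_
    · simpa [Tm.subst] using .tensor hV.eval hV'.eval
    · simpa [Tm.subst, hF.subst_closed, hG.subst_closed, hV.2.subst_closed,
        hV'.2.subst_closed] using .tensor hA hA'
  · refine .letTensor (V := U) (U := U') ?_ ?_
    · simpa [Tm.subst] using .tensor hU.eval hU'.eval
    · simpa [Tm.subst, hF.subst_closed, hG.subst_closed, hU.2.subst_closed,
        hU'.2.subst_closed] using .tensor hB hB'

/-- Applying the tested function to a fixed closed argument is itself a test, `λz. H (z V)`. -/
theorem Conv.app {τ σ ρ : Ty} {F G V A B : Tm S} (hF : IsValue F) (hG : IsValue G)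
    (hV : IsClosedValue τ V) (h : Conv σ (.app F V) (.app G V) ρ A B) :
    Conv (.lolli τ σ) F G ρ A B := by
  obtain ⟨H, hH, hA, hB⟩ := h
  refine .of_forall (x := 0) (L := .app H (.app (.var 0) V))
    (.app hH (.app (.var 0 _) hV.2 (.nil_right _) (by simp [Env.WF])) (.nil_left _)
      (by simp [Env.WF])) hF hG ?_ ?_
  · simpa [Tm.subst, hH.subst_closed, hV.2.subst_closed] using hA
  · simpa [Tm.subst, hH.subst_closed, hV.2.subst_closed] using hB

/-- The supremum of the first-order distances of the results of applicative tests. -/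
noncomputable def appDist (τ : Ty) (M N : Tm S) : ℝ≥0∞ :=
  sSup {d | ∃ σ V U, Conv τ M N σ V U ∧ d = outDist V U}

theorem Conv.outDist_le {τ σ : Ty} {M N V U : Tm S} (h : Conv τ M N σ V U) :
    outDist V U ≤ appDist τ M N :=
  le_sSup ⟨σ, V, U, h, rfl⟩

/-- Induction on the type, after passing to values. Base types are tested by the identity, `⊗` uses
parallel tests, and `⊸` uses the triangle inequality together with the fundamental lemma. -/
theorem logRel_of_appDist_le {τ : Ty} {M N : Tm S} (hM : HasType [] M τ) (hN : HasType [] N τ)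
    {r : ℝ≥0∞} (h : appDist τ M N ≤ r) : LogRel τ r M N := by
  obtain ⟨V, hMV⟩ := hM.exists_eval
  obtain ⟨U, hNU⟩ := hN.exists_eval
  have hV := hMV.isClosedValue hM
  have hU := hNU.isClosedValue hN
  have hr : ∀ σ A B, Conv τ V U σ A B → outDist A B ≤ r := fun σ A B hc =>
    ((Conv.eval_iff hMV hNU).2 hc).outDist_le.trans h
  rw [LogRel.eval_iff hMV hNU]
  clear h hMV hNU hM hN
  induction τ generalizing V U r with
  | real =>
    obtain ⟨a, rfl⟩ := hV.exists_const
    obtain ⟨b, rfl⟩ := hU.exists_const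
    exact ⟨a, b, hV.eval, hU.eval, hr _ _ _ (.refl hV.eval hU.eval)⟩
  | unit =>
    rw [hV.eq_star, hU.eq_star]
    exact ⟨.value .star, .value .star⟩
  | tensor τ σ ih₁ ih₂ =>
    obtain ⟨V₁, V₂, rfl, hV₁, hV₂⟩ := hV.exists_tensor
    obtain ⟨U₁, U₂, rfl, hU₁, hU₂⟩ := hU.exists_tensor
    refine ⟨V₁, V₂, U₁, U₂, hV.eval, hU.eval, appDist τ V₁ U₁, appDist σ V₂ U₂,
      ih₁ _ _ hV₁ hU₁ fun ρ A B hc => hc.outDist_le,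
      ih₂ _ _ hV₂ hU₂ fun ρ A B hc => hc.outDist_le, ?_⟩
    rw [appDist, appDist, sSup_eq_iSup, sSup_eq_iSup]
    -- A sum of two suprema over non-empty families is bounded once all pairwise sums are; the
    -- identity test shows non-emptiness.
    refine ENNReal.biSup_add_biSup_le' ⟨_, _, _, _, .refl hV₁.eval hU₁.eval, rfl⟩
      ⟨_, _, _, _, .refl hV₂.eval hU₂.eval, rfl⟩ ?_
    rintro _ ⟨ρ, A, B, hc, rfl⟩ _ ⟨ρ', A', B', hc', rfl⟩
    exact hr _ _ _ (.tensor hV₁ hV₂ hU₁ hU₂ hc hc')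
  | lolli τ σ _ ih =>
    have hVt := hV.2
    have hUt := hU.2
    obtain ⟨x, L, rfl, hL⟩ := hV.exists_lam
    obtain ⟨y, L', rfl, hL'⟩ := hU.exists_lam
    refine ⟨x, y, L, L', hV.eval, hU.eval, fun W W' s hW hW' hWW' => ?_⟩
    obtain ⟨X, hX⟩ := (hL.subst hW.2).exists_eval
    obtain ⟨X', hX'⟩ := (hL'.subst hW'.2).exists_eval
    rw [LogRel.eval_iff hX hX']
    refine ih _ _ (hX.isClosedValue (hL.subst hW.2))
      (hX'.isClosedValue (hL'.subst hW'.2)) ?_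
    rintro ρ A B ⟨F, hF, hA, hB⟩
    have hAF : Eval (.app F (.app (.lam x τ L) W)) A :=
      (Eval.app_arg_iff ((Eval.app_lam_iff hW.1 _).2 hX) _).2 hA
    have hBF : Eval (.app F (.app (.lam y τ L') W')) B :=
      (Eval.app_arg_iff ((Eval.app_lam_iff hW'.1 _).2 hX') _).2 hB
    -- The test `F` and the right-hand function are at distance `0` from themselves, so replacing
    -- `W` by `W'` costs at most `s`.
    have hrel := (hF.openRel.app (hUt.openRel.app ((openRel_nil_iff hW.2 hW'.2).2 hWW') .nil
      Env.wf_nil) .nil Env.wf_nil)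
    have hl := hrel.logRel
    obtain ⟨C, _, hC, hB'⟩ := hl.exists_eval
    cases hBF.det hB'
    have hclA := hAF.isClosedValue
      (.app hF (.app hVt hW.2 .nil Env.wf_nil) .nil Env.wf_nil)
    have hclC := hC.isClosedValue hrel.left
    have hclB := hBF.isClosedValue hrel.right
    rw [LogRel.eval_iff hC hBF, zero_add, zero_add] at hl
    -- The intermediate value `C` comes from the right-hand function applied to the left-hand
    -- argument `W`: changing the function costs at most `r`, changing the argument at most `s`.
    exact (outDist_triangle hclA hclC hclB).trans (add_le_add
      (hr _ _ _ (.app hV.1 hU.1 hW ⟨F, hF, hAF, hC⟩)) (hl.outDist_le hclC hclB))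

/-! ### Bringing the numerals of a value to the front -/

/-- Moves a component without numerals behind the part that is still to be processed. -/
theorem Conv.rotate {α β δ : Ty} {A A' B B' D D' : Tm S} (hA : IsClosedValue α A)
    (hA' : IsClosedValue α A') (hB : IsClosedValue β B) (hB' : IsClosedValue β B')
    (hD : IsClosedValue δ D) (hD' : IsClosedValue δ D') :
    Conv (.tensor α (.tensor β δ)) (.tensor A (.tensor B D)) (.tensor A' (.tensor B' D'))
      (.tensor α (.tensor δ β)) (.tensor A (.tensor D B)) (.tensor A' (.tensor D' B')) := by
  refine .of_forall (x := 0)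
    (L := .letTensor 1 2 (.var 0) (.letTensor 3 4 (.var 2)
      (.tensor (.var 1) (.tensor (.var 4) (.var 3)))))
    (.letTensor (.var 0 _) (.letTensor (Γ := [(2, .tensor β δ)]) (Δ := [(1, α)]) (.var 2 _)
      (.tensor (Γ := [(1, α)]) (Δ := [(4, δ), (3, β)]) (.var 1 _)
        (.tensor (.var 4 _) (.var 3 _) (.left _ (.right _ .nil)) (by simp [Env.WF]))
        (.right _ (.right _ (.left _ .nil))) (by simp [Env.WF]))
      (.left _ (.right _ .nil)) (by simp [Env.WF])) (.nil_right _) (by simp [Env.WF]))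
    (hA.tensor (hB.tensor hD)).1 (hA'.tensor (hB'.tensor hD')).1 ?_ ?_
  · refine .letTensor (V := A) (U := .tensor B D) ?_ (.letTensor (V := B) (U := D) ?_ ?_)
    · simpa [Tm.subst] using (hA.tensor (hB.tensor hD)).eval
    · simpa [Tm.subst] using (hB.tensor hD).eval
    · simpa [Tm.subst, hA.2.subst_closed, hB.2.subst_closed, hD.2.subst_closed] using
        (hA.tensor (hD.tensor hB)).eval
  · refine .letTensor (V := A') (U := .tensor B' D') ?_ (.letTensor (V := B') (U := D') ?_ ?_)
    · simpa [Tm.subst] using (hA'.tensor (hB'.tensor hD')).eval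
    · simpa [Tm.subst] using (hB'.tensor hD').eval
    · simpa [Tm.subst, hA'.2.subst_closed, hB'.2.subst_closed, hD'.2.subst_closed] using
        (hA'.tensor (hD'.tensor hB')).eval

theorem Conv.assoc {α β δ ε : Ty} {A A' B B' D D' E E' : Tm S} (hA : IsClosedValue α A)
    (hA' : IsClosedValue α A') (hB : IsClosedValue β B) (hB' : IsClosedValue β B')
    (hD : IsClosedValue δ D) (hD' : IsClosedValue δ D') (hE : IsClosedValue ε E)
    (hE' : IsClosedValue ε E') :
    Conv (.tensor α (.tensor (.tensor β δ) ε)) (.tensor A (.tensor (.tensor B D) E))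
      (.tensor A' (.tensor (.tensor B' D') E'))
      (.tensor α (.tensor β (.tensor δ ε))) (.tensor A (.tensor B (.tensor D E)))
      (.tensor A' (.tensor B' (.tensor D' E'))) := by
  refine .of_forall (x := 0)
    (L := .letTensor 1 2 (.var 0) (.letTensor 3 4 (.var 2) (.letTensor 5 6 (.var 3)
      (.tensor (.var 1) (.tensor (.var 5) (.tensor (.var 6) (.var 4)))))))
    (.letTensor (.var 0 _) (.letTensor (Γ := [(2, .tensor (.tensor β δ) ε)]) (Δ := [(1, α)])
      (.var 2 _)
      (.letTensor (Γ := [(3, .tensor β δ)]) (Δ := [(4, ε), (1, α)]) (.var 3 _)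
        (.tensor (Γ := [(1, α)]) (Δ := [(6, δ), (5, β), (4, ε)]) (.var 1 _)
          (.tensor (Γ := [(5, β)]) (Δ := [(6, δ), (4, ε)]) (.var 5 _)
            (.tensor (.var 6 _) (.var 4 _) (.left _ (.right _ .nil)) (by simp [Env.WF]))
            (.right _ (.left _ (.right _ .nil))) (by simp [Env.WF]))
          (.right _ (.right _ (.right _ (.left _ .nil)))) (by simp [Env.WF]))
        (.right _ (.left _ (.right _ .nil))) (by simp [Env.WF]))
      (.left _ (.right _ .nil)) (by simp [Env.WF])) (.nil_right _) (by simp [Env.WF]))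
    (hA.tensor ((hB.tensor hD).tensor hE)).1 (hA'.tensor ((hB'.tensor hD').tensor hE')).1 ?_ ?_
  · refine .letTensor (V := A) (U := .tensor (.tensor B D) E) ?_
      (.letTensor (V := .tensor B D) (U := E) ?_ (.letTensor (V := B) (U := D) ?_ ?_))
    · simpa [Tm.subst] using (hA.tensor ((hB.tensor hD).tensor hE)).eval
    · simpa [Tm.subst] using ((hB.tensor hD).tensor hE).eval
    · simpa [Tm.subst, hB.2.subst_closed, hD.2.subst_closed] using (hB.tensor hD).eval
    · simpa [Tm.subst, hA.2.subst_closed, hB.2.subst_closed, hD.2.subst_closed,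
        hE.2.subst_closed] using (hA.tensor (hB.tensor (hD.tensor hE))).eval
  · refine .letTensor (V := A') (U := .tensor (.tensor B' D') E') ?_
      (.letTensor (V := .tensor B' D') (U := E') ?_ (.letTensor (V := B') (U := D') ?_ ?_))
    · simpa [Tm.subst] using (hA'.tensor ((hB'.tensor hD').tensor hE')).eval
    · simpa [Tm.subst] using ((hB'.tensor hD').tensor hE').eval
    · simpa [Tm.subst, hB'.2.subst_closed, hD'.2.subst_closed] using (hB'.tensor hD').eval
    · simpa [Tm.subst, hA'.2.subst_closed, hB'.2.subst_closed, hD'.2.subst_closed,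
        hE'.2.subst_closed] using (hA'.tensor (hB'.tensor (hD'.tensor hE'))).eval

/-- The tuple `M` extended by the number `N` if `M` has length `n`. -/
def Tm.snoc (n : ℕ) (M N : Tm S) : Tm S := if n = 0 then .letStar M N else .tensor M N

theorem Tm.subst_snoc (n : ℕ) (M N : Tm S) (x : Var) (V : Tm S) :
    (Tm.snoc n M N).subst x V = Tm.snoc n (M.subst x V) (N.subst x V) := by
  unfold Tm.snoc
  split <;> rfl

/-- The power with one factor is `R` and not `I ⊗ R`, so an empty tuple must be consumed by `let *`
instead of being paired. -/
theorem HasType.snoc {n : ℕ} {Γ Δ Ξ : Env} {M N : Tm S} (hM : HasType Γ M (Ty.rpow n))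
    (hN : HasType Δ N .real) (hm : Merge Γ Δ Ξ) (hw : Ξ.WF) :
    HasType Ξ (Tm.snoc n M N) (Ty.rpow (n + 1)) := by
  cases n with
  | zero => exact .letStar hM hN hm hw
  | succ n => exact .tensor hM hN hm hw

theorem eval_snoc_tuple (n : ℕ) (a : Fin n → ℝ) (c : ℝ) :
    Eval (S := S) (Tm.snoc n (Tm.tuple n a) (.const c))
      (Tm.tuple (n + 1) (Fin.snoc (α := fun _ => ℝ) a c)) := by
  cases n with
  | zero => exact .letStar (.value .star) (.value (.const c))
  | succ n =>
    simp only [Tm.snoc, Tm.tuple, Fin.snoc_castSucc, Fin.snoc_last]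
    exact ((isClosedValue_tuple _ a).tensor (isClosedValue_const c)).eval

/-- Moves one numeral into the tuple. The final `*` stands for the empty remainder and keeps the
shape uniform for the flattening. -/
theorem Conv.snoc {δ : Ty} (n : ℕ) (a b : Fin n → ℝ) (c d : ℝ) {D D' : Tm S}
    (hD : IsClosedValue δ D) (hD' : IsClosedValue δ D') :
    Conv (.tensor (Ty.rpow n) (.tensor .real δ)) (.tensor (Tm.tuple n a) (.tensor (.const c) D))
      (.tensor (Tm.tuple n b) (.tensor (.const d) D'))
      (.tensor (Ty.rpow (n + 1)) (.tensor δ .unit))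
      (.tensor (Tm.tuple (n + 1) (Fin.snoc (α := fun _ => ℝ) a c)) (.tensor D .star))
      (.tensor (Tm.tuple (n + 1) (Fin.snoc (α := fun _ => ℝ) b d)) (.tensor D' .star)) := by
  have hs : ∀ (n : ℕ) (a : Fin n → ℝ) (x : Var) (V : Tm S),
      (Tm.tuple n a).subst x V = Tm.tuple n a := fun n a => (isClosedValue_tuple n a).2.subst_closed
  have hv : ∀ (n : ℕ) (a : Fin n → ℝ) (c : ℝ) (D : Tm S), IsClosedValue δ D →
      IsClosedValue _ (.tensor (Tm.tuple n a) (.tensor (.const c) D)) := fun n a c D hD =>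
    (isClosedValue_tuple n a).tensor ((isClosedValue_const c).tensor hD)
  refine .of_forall (x := 0)
    (L := .letTensor 1 2 (.var 0) (.letTensor 3 4 (.var 2)
      (.tensor (Tm.snoc n (.var 1) (.var 3)) (.tensor (.var 4) .star))))
    (.letTensor (.var 0 _) (.letTensor (Γ := [(2, .tensor .real δ)]) (Δ := [(1, Ty.rpow n)])
      (.var 2 _)
      (.tensor (Γ := [(3, .real), (1, Ty.rpow n)]) (Δ := [(4, δ)])
        (.snoc (.var 1 _) (.var 3 _) (.right _ (.left _ .nil)) (by simp [Env.WF]))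
        (.tensor (.var 4 _) .star (.nil_right _) (by simp [Env.WF]))
        (.right _ (.nil_right _)) (by simp [Env.WF]))
      (.left _ (.right _ .nil)) (by simp [Env.WF])) (.nil_right _) (by simp [Env.WF]))
    (hv n a c D hD).1 (hv n b d D' hD').1 ?_ ?_
  · refine .letTensor (V := Tm.tuple n a) (U := .tensor (.const c) D) ?_
      (.letTensor (V := .const c) (U := D) ?_ ?_)
    · simpa [Tm.subst] using (hv n a c D hD).eval
    · simpa [Tm.subst] using ((isClosedValue_const c).tensor hD).eval
    · simpa [Tm.subst, Tm.subst_snoc, hs, hD.2.subst_closed] using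
        .tensor (eval_snoc_tuple n a c) (hD.tensor isClosedValue_star).eval
  · refine .letTensor (V := Tm.tuple n b) (U := .tensor (.const d) D') ?_
      (.letTensor (V := .const d) (U := D') ?_ ?_)
    · simpa [Tm.subst] using (hv n b d D' hD').eval
    · simpa [Tm.subst] using ((isClosedValue_const d).tensor hD').eval
    · simpa [Tm.subst, Tm.subst_snoc, hs, hD'.2.subst_closed] using
        .tensor (eval_snoc_tuple n b d) (hD'.tensor isClosedValue_star).eval

/-- The state consists of the tuple collected so far, the value `V` to be processed, and a queue `W`
of type `ρ`. Processing `V` puts its numerals into the tuple and its remainder `X` behind the queue.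
Arbitrary tuple and queue are needed for the induction: in a pair, the second component waits at the
head of the queue while the first is processed. -/
theorem exists_conv_flatten (σ : Ty) (n : ℕ) (a b : Fin n → ℝ) {ρ : Ty} {V U W W' : Tm S}
    (hV : IsClosedValue σ V) (hU : IsClosedValue σ U) (hW : IsClosedValue ρ W)
    (hW' : IsClosedValue ρ W') :
    ∃ (n' : ℕ) (a' b' : Fin n' → ℝ) (ρ' : Ty) (X X' : Tm S),
      IsClosedValue ρ' X ∧ IsClosedValue ρ' X' ∧
      Conv (.tensor (Ty.rpow n) (.tensor σ ρ)) (.tensor (Tm.tuple n a) (.tensor V W))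
        (.tensor (Tm.tuple n b) (.tensor U W')) (.tensor (Ty.rpow n') (.tensor ρ ρ'))
        (.tensor (Tm.tuple n' a') (.tensor W X)) (.tensor (Tm.tuple n' b') (.tensor W' X')) ∧
      ENNReal.ofReal (∑ i, |a' i - b' i|) = ENNReal.ofReal (∑ i, |a i - b i|) + outDist V U := by
  induction σ generalizing n a b ρ V U W W' with
  | real =>
    obtain ⟨c, rfl⟩ := hV.exists_const
    obtain ⟨d, rfl⟩ := hU.exists_const
    refine ⟨_, _, _, _, _, _, isClosedValue_star, isClosedValue_star, .snoc n a b c d hW hW', ?_⟩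
    rw [Fin.sum_univ_castSucc, ENNReal.ofReal_add (Finset.sum_nonneg fun _ _ => abs_nonneg _)
      (abs_nonneg _)]
    simp [outDist]
  | unit =>
    refine ⟨n, a, b, _, V, U, hV, hU,
      .rotate (isClosedValue_tuple n a) (isClosedValue_tuple n b) hV hU hW hW', ?_⟩
    rw [hV.eq_star]
    simp [outDist]
  | lolli =>
    refine ⟨n, a, b, _, V, U, hV, hU,
      .rotate (isClosedValue_tuple n a) (isClosedValue_tuple n b) hV hU hW hW', ?_⟩
    obtain ⟨_, _, rfl, -⟩ := hV.exists_lam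
    simp [outDist]
  | tensor σ₁ σ₂ ih₁ ih₂ =>
    obtain ⟨V₁, V₂, rfl, hV₁, hV₂⟩ := hV.exists_tensor
    obtain ⟨U₁, U₂, rfl, hU₁, hU₂⟩ := hU.exists_tensor
    obtain ⟨n₁, a₁, b₁, ρ₁, X₁, X₁', hX₁, hX₁', hc₁, hd₁⟩ :=
      ih₁ n a b hV₁ hU₁ (hV₂.tensor hW) (hU₂.tensor hW')
    obtain ⟨n₂, a₂, b₂, ρ₂, X₂, X₂', hX₂, hX₂', hc₂, hd₂⟩ :=
      ih₂ n₁ a₁ b₁ hV₂ hU₂ (hW.tensor hX₁) (hW'.tensor hX₁')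
    refine ⟨n₂, a₂, b₂, .tensor ρ₁ ρ₂, _, _, hX₁.tensor hX₂, hX₁'.tensor hX₂', ?_, ?_⟩
    · have t₀ := isClosedValue_tuple (S := S) n
      have t₁ := isClosedValue_tuple (S := S) n₁
      have t₂ := isClosedValue_tuple (S := S) n₂
      -- Reassociation exposes `V₁`, then `V₂`, and finally groups the two remainders `X₁` and `X₂`
      -- behind `W`.
      exact ((((Conv.assoc (t₀ a) (t₀ b) hV₁ hU₁ hV₂ hU₂ hW hW').trans hc₁).trans
        (.assoc (t₁ a₁) (t₁ b₁) hV₂ hU₂ hW hW' hX₁ hX₁')).trans hc₂).trans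
        (.assoc (t₂ a₂) (t₂ b₂) hW hW' hX₁ hX₁' hX₂ hX₂')
    · rw [hd₂, hd₁, outDist, add_assoc]

theorem Conv.exists_tuple {τ σ : Ty} {M N V U : Tm S} (hM : HasType [] M τ)
    (hN : HasType [] N τ) (h : Conv τ M N σ V U) :
    ∃ (n : ℕ) (a b : Fin n → ℝ) (ρ : Ty) (X X' : Tm S),
      Conv τ M N (.tensor (Ty.rpow n) ρ) (.tensor (Tm.tuple n a) X) (.tensor (Tm.tuple n b) X') ∧
      ENNReal.ofReal (∑ i, |a i - b i|) = outDist V U := by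
  obtain ⟨hV, hU⟩ : IsClosedValue σ V ∧ IsClosedValue σ U := by
    obtain ⟨F, hF, h₁, h₂⟩ := h
    exact ⟨h₁.isClosedValue (.app hF hM .nil Env.wf_nil),
      h₂.isClosedValue (.app hF hN .nil Env.wf_nil)⟩
  -- The flattening starts with the empty tuple and the queue `*`.
  obtain ⟨n, a, b, ρ, X, X', -, -, hc, hd⟩ := exists_conv_flatten σ 0 Fin.elim0 Fin.elim0 hV hU
    isClosedValue_star isClosedValue_star
  refine ⟨n, a, b, _, _, _, (h.trans ?_).trans hc, by simpa using hd⟩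
  refine .of_forall (x := 0) (L := .tensor .star (.tensor (.var 0) .star))
    (.tensor .star (.tensor (.var 0 _) .star (.nil_right _) (by simp [Env.WF])) (.nil_left _)
      (by simp [Env.WF])) hV.1 hU.1 ?_ ?_
  · simpa [Tm.subst, Tm.tuple] using
      (isClosedValue_star.tensor (hV.tensor isClosedValue_star)).eval
  · simpa [Tm.subst, Tm.tuple] using
      (isClosedValue_star.tensor (hU.tensor isClosedValue_star)).eval

/-- For `Γ = (x : σ, …, y : ρ)`, the context `λx:σ. ⋯ λy:ρ. C`. -/
def Env.closeCxt : Env → Cxt S → Cxt S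
  | [], C => C
  | (y, ρ) :: Γ, C => Env.closeCxt Γ (.lam y ρ C)

theorem Env.plug_closeCxt (Γ : Env) (C : Cxt S) (P : Tm S) :
    (Γ.closeCxt C).plug P = Γ.close (C.plug P) := by
  induction Γ generalizing C with
  | nil => rfl
  | cons p Γ ih => exact ih _

/-! ### Applicative tests as contexts and the bound `dLog ≤ dObs` -/

theorem appDist_close_le_dObs (S : Set NonExp) (Γ : Env) (τ : Ty) (M N : Term S Γ τ) :
    appDist (Γ.closeTy τ) (Γ.close M.1) (Γ.close N.1) ≤ dObs S Γ τ M N := by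
  refine sSup_le ?_
  rintro _ ⟨σ, V, U, hc, rfl⟩
  obtain ⟨n, a, b, ρ, X, X', ⟨F, hF, h₁, h₂⟩, hd⟩ := hc.exists_tuple M.2.close N.2.close
  -- The observing context closes the hole by λ-abstractions over `Γ` and applies the test `F` to
  -- the result.
  refine le_sSup ⟨n, ρ, .appR F (Γ.closeCxt .hole), fun P hP => ?_, a, b, X, X', ?_, ?_, hd.symm⟩
  · rw [Cxt.plug, Env.plug_closeCxt]
    exact .app hF hP.close .nil Env.wf_nil
  · rwa [Cxt.plug, Env.plug_closeCxt]
  · rwa [Cxt.plug, Env.plug_closeCxt]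

/-- The observational distance is itself one of the radii over which the infimum is taken, so no
limit argument is needed. -/
theorem dLog_le_dObs (S : Set NonExp) (Γ : Env) (τ : Ty) (M N : Term S Γ τ) :
    dLog S Γ τ M N ≤ dObs S Γ τ M N :=
  sInf_le (logRel_of_appDist_le M.2.close N.2.close (appDist_close_le_dObs S Γ τ M N))

end LinLang

theorem mainTheorem3 (S : Set NonExp) (Γ : LinLang.Env) (hΓ : Γ.WF) (τ : LinLang.Ty) :
    LinLang.dObs S Γ τ = LinLang.dLog S Γ τ := by
  funext M N
  exact le_antisymm (LinLang.dObs_le_dLog S Γ τ M N) (LinLang.dLog_le_dObs S Γ τ M N)
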